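/- Let $R$ be a commutative ring with identity, and let $C$ be a semidualizing $R$-module; that is, $C$ has a resolution by finitely generated projective modules, the homothety map $R\to\operatorname{Hom}_R(C,C)$ is an isomorphism, and $\operatorname{Ext}_R^n(C,C)=0$ for all $n\ge 1$. An $R$-module is called $C$-projective (resp. $C$-flat) if it is isomorphic to $C\otimes_R P$ with $P$ projective (resp. $C\otimes_R F$ with $F$ flat). A $\mathbb Z$-indexed chain complex $X$ of $R$-modules is called projective (resp. $C$-projective, $C$-flat) if $X$ is exact and every cycle module $Z_i(X)$, $i\in\mathbb Z$, is projective (resp. $C$-projective, $C$-flat). A sequence $\mathbf E$ of complexes is called $\operatorname{Hom}(-,\widetilde{\mathcal F_C(R)})$-exact if the sequence of abelian groups $\operatorname{Hom}(\mathbf E,H)$ is exact for every $C$-flat complex $H$, where $\operatorname{Hom}$ is the group of chain maps. A complex $X$ is called $D_C$-projective if there is a $\operatorname{Hom}(-,\widetilde{\mathcal F_C(R)})$-exact exact sequence of complexes $$\cdots\to P_1\xrightarrow{f_1}P_0\xrightarrow{f_0}Q_{-1}\xrightarrow{f_{-1}}Q_{-2}\xrightarrow{f_{-2}}\cdots\qquad(*)$$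 with all $P_i$ projective complexes and all $Q_i$ $C$-projective complexes such that $X\cong\operatorname{Im}f_0$. **Corollary 2.13.** For every $\operatorname{Hom}(-,\widetilde{\mathcal F_C(R)})$-exact exact sequence $(*)$ of complexes of $R$-modules with all $P_i$ projective complexes and all $Q_i$ $C$-projective complexes, the complex $\operatorname{Coker}f_i$ is $D_C$-projective for every $i\in\mathbb Z$. -/

import Mathlib

open CategoryTheory CategoryTheory.Limits
open scoped TensorProduct

universe u

namespace DingC

section Sequences

universe v w

variable {𝒜 : Type w} [Category.{v} 𝒜] [Preadditive 𝒜]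

/-- Given a class `𝓑` of objects, a doubly infinite sequence
`⋯ ⟶ E_{i+1} ⟶ E_i ⟶ E_{i-1} ⟶ ⋯` with vanishing composites is `Hom(-, 𝓑)`-exact if, for
every `B` in `𝓑`, the sequence of abelian groups
`⋯ ⟶ Hom(E_{i-1}, B) ⟶ Hom(E_i, B) ⟶ Hom(E_{i+1}, B) ⟶ ⋯` is exact. -/
def IsHomExact (𝓑 : ObjectProperty 𝒜) (E : ChainComplex 𝒜 ℤ) : Prop :=
  ∀ B : 𝒜, 𝓑 B → ∀ i : ℤ,
    Function.Exact (fun h : E.X (i - 1) ⟶ B => E.d i (i - 1) ≫ h)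
      (fun g : E.X i ⟶ B => E.d (i + 1) i ≫ g)

end Sequences

variable {R : Type u} [CommRing R]

/-- `C` is semidualizing: it has a resolution by finitely generated projective modules, the
homothety map `R → Hom_R(C, C)` is an isomorphism, and `Ext^n_R(C, C) = 0` for all `n ≥ 1`. -/
structure IsSemidualizing (C : ModuleCat.{u} R) : Prop where
  exists_resolution : ∃ P : ProjectiveResolution C, ∀ n : ℕ, Module.Finite R (P.complex.X n)
  homothety_bijective : Function.Bijective (algebraMap R (Module.End R C))
  ext_eq_zero : ∀ n : ℕ, 1 ≤ n → Subsingleton (Abelian.Ext C C n)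

/-- The class `𝒫(R)` of projective modules. -/
def projectiveModules (R : Type u) [CommRing R] : ObjectProperty (ModuleCat.{u} R) :=
  fun M => Module.Projective R M

/-- The class `𝒫_C(R)` of `C`-projective modules: those of the form `C ⊗ P`, `P` projective. -/
def cProjectiveModules (C : ModuleCat.{u} R) : ObjectProperty (ModuleCat.{u} R) :=
  fun M => ∃ P : ModuleCat.{u} R, Module.Projective R P ∧ Nonempty (M ≃ₗ[R] C ⊗[R] P)

/-- The class `ℱ_C(R)` of `C`-flat modules: those of the form `C ⊗ F`, `F` flat. -/
def cFlatModules (C : ModuleCat.{u} R) : ObjectProperty (ModuleCat.{u} R) :=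
  fun M => ∃ F : ModuleCat.{u} R, Module.Flat R F ∧ Nonempty (M ≃ₗ[R] C ⊗[R] F)

/-- For a class `𝒳` of modules, the class of `𝒳`-complexes: the exact complexes all of whose
cycle modules lie in `𝒳`. -/
def tildeClass (𝒳 : ObjectProperty (ModuleCat.{u} R)) :
    ObjectProperty (ChainComplex (ModuleCat.{u} R) ℤ) :=
  fun X => X.Acyclic ∧ ∀ i : ℤ, 𝒳 (X.cycles i)

/-- The class of projective complexes. -/
def projectiveComplexes (R : Type u) [CommRing R] :
    ObjectProperty (ChainComplex (ModuleCat.{u} R) ℤ) :=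
  tildeClass (projectiveModules R)

/-- The class of `C`-projective complexes. -/
def cProjectiveComplexes (C : ModuleCat.{u} R) :
    ObjectProperty (ChainComplex (ModuleCat.{u} R) ℤ) :=
  tildeClass (cProjectiveModules C)

/-- The class of `C`-flat complexes. -/
def cFlatComplexes (C : ModuleCat.{u} R) :
    ObjectProperty (ChainComplex (ModuleCat.{u} R) ℤ) :=
  tildeClass (cFlatModules C)

/-- `E` is an exact sequence of complexes
`⋯ ⟶ P_1 ⟶ P_0 ⟶ Q_{-1} ⟶ Q_{-2} ⟶ ⋯` that is `Hom(-, H)`-exact for all `C`-flat complexes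
`H`, with all `P_i` projective complexes and all `Q_i` `C`-projective complexes.
The map leaving the term of index `i` is `E.d i (i - 1)`. -/
structure IsPQSequence (C : ModuleCat.{u} R)
    (E : ChainComplex (ChainComplex (ModuleCat.{u} R) ℤ) ℤ) : Prop where
  exact : E.Acyclic
  homExact : IsHomExact (cFlatComplexes C) E
  projective : ∀ i : ℤ, 0 ≤ i → projectiveComplexes R (E.X i)
  cProjective : ∀ i : ℤ, i < 0 → cProjectiveComplexes C (E.X i)

/-- A complex `X` is `D_C`-projective if it is isomorphic to the image of the middle map
`P_0 ⟶ Q_{-1}` of some sequence as in `IsPQSequence`. -/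
def IsDCProjective (C : ModuleCat.{u} R) (X : ChainComplex (ModuleCat.{u} R) ℤ) : Prop :=
  ∃ E : ChainComplex (ChainComplex (ModuleCat.{u} R) ℤ) ℤ,
    IsPQSequence C E ∧ Nonempty (X ≅ image (E.d 0 (-1)))

end DingC

/-! For exact `E`, the cokernels in question are the objects `E.opcycles j`. Call a complex
orthogonal if its positive `Ext` into every `C`-flat complex vanishes. An orthogonal complex is
`D_C`-projective as soon as it has a right coresolution by `C`-projective complexes with orthogonal
cosyzygies: any projective resolution supplies the left half, and orthogonality makes the spliced
sequence Hom-exact (`isDCProjective_of_coresolved`). The class `coresolved` collects these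
complexes.

Hom-exactness and dimension shifting make every `E.opcycles j` orthogonal. For `j ≤ 0` the tail of
`E` is the required coresolution. For `j > 0` one climbs through the projective terms: given `0 → K
→ P → X → 0` with `X` coresolved, embed `P` in a `C`-projective `Q` with coresolved cokernel `Y`.
Then `K ⊆ Q`, and `0 → X → Q/K → Y → 0` is exact, so `Q/K` is coresolved by the horseshoe argument
in `coresolved_of_shortExact`.

This needs projective complexes to be coresolved. They are sums of disks, which reduces the question
to a projective module `P`. Applying `Hom(-, C) ⊗ P` to a resolution of `C` by finitely generated
projectives gives a `C`-projective coresolution of `P`. Its cosyzygies are orthogonal because `M ⊗ F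
→ Hom(Hom(M, C), C ⊗ F)` is bijective for every syzygy `M` of `C` and flat `F`
(`bidualMap_bijective`). -/

namespace DingC

/-! ### Ext vanishing along short exact sequences. -/

section ExtVanishing

universe v w w'

open Abelian

variable {𝒜 : Type w} [Category.{v} 𝒜] [Abelian 𝒜] [HasExt.{w'} 𝒜]

/-- `Ext^n(X, Y) = 0` for all `n ≥ 1`. -/
def ExtVanishes (X Y : 𝒜) : Prop :=
  ∀ (n : ℕ) (e : Ext X Y (n + 1)), e = 0

lemma ExtVanishes.of_projective (X Y : 𝒜) [Projective X] : ExtVanishes X Y :=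
  fun _ e => e.eq_zero_of_projective

lemma ExtVanishes.of_iso_left {X X' Y : 𝒜} (e : X ≅ X') (h : ExtVanishes X Y) :
    ExtVanishes X' Y := by
  intro n x
  have hx : (Ext.mk₀ e.inv).comp ((Ext.mk₀ e.hom).comp x (zero_add _)) (zero_add _) = x := by
    rw [Ext.mk₀_comp_mk₀_assoc, e.inv_hom_id, Ext.mk₀_id_comp]
  rw [← hx, h n ((Ext.mk₀ e.hom).comp x (zero_add _)), Ext.comp_zero]

lemma ExtVanishes.of_iso_right {X Y Y' : 𝒜} (e : Y ≅ Y') (h : ExtVanishes X Y) :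
    ExtVanishes X Y' := by
  intro n x
  have hx : (x.comp (Ext.mk₀ e.inv) (add_zero _)).comp (Ext.mk₀ e.hom) (add_zero _) = x := by
    rw [Ext.comp_assoc_of_third_deg_zero, Ext.mk₀_comp_mk₀, e.inv_hom_id, Ext.comp_mk₀_id]
  rw [← hx, h n (x.comp (Ext.mk₀ e.inv) (add_zero _)), Ext.zero_comp]

/-- The obstruction to extending `g` lies in `Ext^1(S.X₃, Y)`. -/
lemma ExtVanishes.exists_extension {S : ShortComplex 𝒜} (hS : S.ShortExact) {Y : 𝒜}
    (h : ExtVanishes S.X₃ Y) (g : S.X₁ ⟶ Y) : ∃ k : S.X₂ ⟶ Y, S.f ≫ k = g := by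
  obtain ⟨x, hx⟩ := Ext.contravariant_sequence_exact₁ hS Y (Ext.mk₀ g) (add_zero 1) (h 0 _)
  obtain ⟨k, rfl⟩ := Ext.mk₀_bijective _ _ |>.2 x
  exact ⟨k, (Ext.mk₀_bijective _ _).1 (by rw [← hx, Ext.mk₀_comp_mk₀])⟩

lemma ExtVanishes.of_shortExact₁ {S : ShortComplex 𝒜} (hS : S.ShortExact) {Y : 𝒜}
    (h₂ : ExtVanishes S.X₂ Y) (h₃ : ExtVanishes S.X₃ Y) : ExtVanishes S.X₁ Y := by
  intro n x
  obtain ⟨x₂, rfl⟩ := Ext.contravariant_sequence_exact₁ hS Y x (add_comm 1 (n + 1)) (h₃ _ _)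
  rw [h₂ n x₂, Ext.comp_zero]

lemma ExtVanishes.of_shortExact₂ {S : ShortComplex 𝒜} (hS : S.ShortExact) {Y : 𝒜}
    (h₁ : ExtVanishes S.X₁ Y) (h₃ : ExtVanishes S.X₃ Y) : ExtVanishes S.X₂ Y := by
  intro n x
  obtain ⟨x₃, rfl⟩ := Ext.contravariant_sequence_exact₂ hS Y x (h₁ _ _)
  rw [h₃ n x₃, Ext.comp_zero]

/-- Dimension shifting along short exact sequences with `Ext`-acyclic middle term. -/
lemma ExtVanishes.of_forall_exists_shortExact (𝒱 : ObjectProperty 𝒜) (Y : 𝒜)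
    (h : ∀ X, 𝒱 X → ∃ (K P : 𝒜) (f : K ⟶ P) (g : P ⟶ X) (w : f ≫ g = 0),
      (ShortComplex.mk f g w).ShortExact ∧ 𝒱 K ∧ ExtVanishes P Y ∧
        ∀ a : K ⟶ Y, ∃ b : P ⟶ Y, f ≫ b = a) {X : 𝒜} (hX : 𝒱 X) : ExtVanishes X Y := by
  intro n
  induction n generalizing X with
  | zero =>
    intro e
    obtain ⟨K, P, f, g, w, hS, -, hP, hf⟩ := h X hX
    obtain ⟨x, rfl⟩ := Ext.contravariant_sequence_exact₃ hS Y e (hP _ _) (add_zero 1)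
    obtain ⟨a, rfl⟩ := Ext.mk₀_bijective _ _ |>.2 x
    obtain ⟨b, rfl⟩ := hf a
    rw [← Ext.mk₀_comp_mk₀]
    exact hS.extClass_comp_assoc _
  | succ n ih =>
    intro e
    obtain ⟨K, P, f, g, w, hS, hK, hP, -⟩ := h X hX
    obtain ⟨x, rfl⟩ := Ext.contravariant_sequence_exact₃ hS Y e (hP _ _) (add_comm 1 (n + 1))
    rw [ih hK x, Ext.comp_zero]

/-- The condition `hf` serves only degree one: it kills the connecting map `Hom(S.X₁, Y) →
Ext^1(S.X₃, Y)`. Higher degrees use `h₁`. -/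
lemma ExtVanishes.of_shortExact₃ {S : ShortComplex 𝒜} (hS : S.ShortExact) {Y : 𝒜}
    (h₁ : ExtVanishes S.X₁ Y) (h₂ : ExtVanishes S.X₂ Y)
    (hf : ∀ a : S.X₁ ⟶ Y, ∃ b : S.X₂ ⟶ Y, S.f ≫ b = a) : ExtVanishes S.X₃ Y := by
  intro n e
  cases n with
  | zero =>
    obtain ⟨x, rfl⟩ := Ext.contravariant_sequence_exact₃ hS Y e (h₂ _ _) (add_zero 1)
    obtain ⟨a, rfl⟩ := Ext.mk₀_bijective _ _ |>.2 x
    obtain ⟨b, rfl⟩ := hf a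
    rw [← Ext.mk₀_comp_mk₀]
    exact hS.extClass_comp_assoc _
  | succ n =>
    obtain ⟨x, rfl⟩ := Ext.contravariant_sequence_exact₃ hS Y e (h₂ _ _) (add_comm 1 (n + 1))
    rw [h₁ n x, Ext.comp_zero]

lemma ExtVanishes.of_shortExact_right {S : ShortComplex 𝒜} (hS : S.ShortExact) {X : 𝒜}
    (h₁ : ExtVanishes X S.X₁) (h₃ : ExtVanishes X S.X₃) : ExtVanishes X S.X₂ := by
  intro n x
  obtain ⟨x₁, rfl⟩ := Ext.covariant_sequence_exact₂ X hS x (h₃ _ _)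
  rw [h₁ n x₁, Ext.zero_comp]

end ExtVanishing

/-! ### Long exact sequences spliced from short ones. -/

section Splicing

universe v w

variable {𝒜 : Type w} [Category.{v} 𝒜] [Abelian 𝒜]

/-- A complex `K` is spliced together from short exact sequences
`0 ⟶ X (j + 1) ⟶ K_j ⟶ X j ⟶ 0`. -/
structure Splicing (K : ChainComplex 𝒜 ℤ) (X : ℤ → 𝒜) where
  i (j : ℤ) : X (j + 1) ⟶ K.X j
  p (j : ℤ) : K.X j ⟶ X j
  zero (j : ℤ) : i j ≫ p j = 0
  shortExact (j : ℤ) : (ShortComplex.mk (i j) (p j) (zero j)).ShortExact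
  d_eq (j : ℤ) : K.d (j + 1) j = p (j + 1) ≫ i j

/-- The complex spliced together from a family of short exact sequences. -/
noncomputable def splice {X E : ℤ → 𝒜} (i : ∀ j, X (j + 1) ⟶ E j) (p : ∀ j, E j ⟶ X j)
    (zero : ∀ j, i j ≫ p j = 0) : ChainComplex 𝒜 ℤ :=
  ChainComplex.of E (fun j => p (j + 1) ≫ i j) (fun j => by
    rw [Category.assoc, reassoc_of% (zero (j + 1)), zero_comp, comp_zero])

/-- The tautological splicing of `splice i p zero`. -/
noncomputable def spliceSplicing {X E : ℤ → 𝒜} (i : ∀ j, X (j + 1) ⟶ E j) (p : ∀ j, E j ⟶ X j)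
    (zero : ∀ j, i j ≫ p j = 0) (hS : ∀ j, (ShortComplex.mk (i j) (p j) (zero j)).ShortExact) :
    Splicing (splice i p zero) X where
  i := i
  p := p
  zero := zero
  shortExact := hS
  d_eq j := ChainComplex.of_d E (fun j => p (j + 1) ≫ i j) j

namespace Splicing

variable {K : ChainComplex 𝒜 ℤ} {X : ℤ → 𝒜} (s : Splicing K X)

include s

lemma mono_i (j : ℤ) : Mono (s.i j) := (s.shortExact j).mono_f

lemma epi_p (j : ℤ) : Epi (s.p j) := (s.shortExact j).epi_g

/-- Precomposing with the epimorphism `s.p` or postcomposing with the monomorphism `s.i` does not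
affect exactness, so both differentials can be traded for the maps of one short exact sequence. -/
lemma acyclic : K.Acyclic := by
  intro j
  obtain ⟨k, rfl⟩ : ∃ k, k + 1 = j := ⟨j - 1, by ring⟩
  have := s.epi_p
  have := s.mono_i
  rw [HomologicalComplex.exactAt_iff' K (k + 1 + 1) (k + 1) k (by simp) (by simp)]
  have h₁ : s.i (k + 1) ≫ K.d (k + 1) k = 0 := by
    rw [s.d_eq, reassoc_of% (s.zero (k + 1)), zero_comp]
  let φ : ShortComplex.mk (s.i (k + 1)) (s.p (k + 1)) (s.zero _) ⟶ ShortComplex.mk _ _ h₁ :=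
    { τ₁ := 𝟙 _, τ₂ := 𝟙 _, τ₃ := s.i k, comm₂₃ := by simp [s.d_eq] }
  change (ShortComplex.mk (K.d (k + 1 + 1) (k + 1)) (K.d (k + 1) k) (K.d_comp_d _ _ _)).Exact
  let ψ : ShortComplex.mk (K.d (k + 1 + 1) (k + 1)) (K.d (k + 1) k) (K.d_comp_d _ _ _) ⟶
      ShortComplex.mk _ _ h₁ :=
    { τ₁ := s.p (k + 1 + 1), τ₂ := 𝟙 _, τ₃ := 𝟙 _, comm₁₂ := by simp [s.d_eq] }
  have : Epi φ.τ₁ := inferInstanceAs (Epi (𝟙 _))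
  have : IsIso φ.τ₂ := inferInstanceAs (IsIso (𝟙 _))
  have : Mono φ.τ₃ := inferInstanceAs (Mono (s.i k))
  have : Epi ψ.τ₁ := inferInstanceAs (Epi (s.p (k + 1 + 1)))
  have : IsIso ψ.τ₂ := inferInstanceAs (IsIso (𝟙 _))
  have : Mono ψ.τ₃ := inferInstanceAs (Mono (𝟙 _))
  rw [ShortComplex.exact_iff_of_epi_of_isIso_of_mono ψ,
    ← ShortComplex.exact_iff_of_epi_of_isIso_of_mono φ]
  exact (s.shortExact (k + 1)).exact

/-- The cycles in degree `j` are `X (j + 1)`. -/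
noncomputable def cyclesIso (j : ℤ) : K.cycles j ≅ X (j + 1) :=
  haveI := s.mono_i
  have w : s.i j ≫ K.d j (j - 1) = 0 := by
    obtain ⟨k, rfl⟩ : ∃ k, k + 1 = j := ⟨j - 1, by ring⟩
    obtain ⟨l, hl⟩ : ∃ l, l = k + 1 - 1 := ⟨_, rfl⟩
    obtain rfl : l = k := by omega
    rw [← hl, s.d_eq, reassoc_of% (s.zero (l + 1)), zero_comp]
  have hl : IsLimit (KernelFork.ofι (s.i j) w) := by
    refine KernelFork.IsLimit.ofι' _ _ fun {A} k hk => ?_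
    refine ⟨(s.shortExact j).exact.lift k ?_, (s.shortExact j).exact.lift_f _ _⟩
    obtain ⟨l, rfl⟩ : ∃ l, l + 1 = j := ⟨j - 1, by ring⟩
    obtain ⟨m, hm⟩ : ∃ m, m = l + 1 - 1 := ⟨_, rfl⟩
    obtain rfl : m = l := by omega
    rw [← hm, s.d_eq] at hk
    rw [← cancel_mono (s.i m), zero_comp, Category.assoc]
    exact hk
  (K.cyclesIsKernel j (j - 1) (by simp)).conePointUniqueUpToIso hl

/-- The image of the differential into degree `j` is `X (j + 1)`. -/
lemma nonempty_imageIso (i j : ℤ) (h : j + 1 = i) : Nonempty (image (K.d i j) ≅ X i) := by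
  subst h
  have := s.epi_p
  have := s.mono_i
  have : StrongEpi (s.p (j + 1)) := strongEpi_of_epi _
  exact ⟨(image.isoStrongEpiMono (s.p (j + 1)) (s.i j) (s.d_eq j).symm).symm⟩

/-- The cokernel of the differential into degree `j` is `X j`. -/
lemma nonempty_cokernelIso (i j : ℤ) (h : j + 1 = i) : Nonempty (cokernel (K.d i j) ≅ X j) := by
  subst h
  have := s.epi_p
  have w : K.d (j + 1) j ≫ s.p j = 0 := by rw [s.d_eq, Category.assoc, s.zero, comp_zero]
  have hl : IsColimit (CokernelCofork.ofπ (s.p j) w) := by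
    refine CokernelCofork.IsColimit.ofπ' _ _ fun {A} k hk => ?_
    refine ⟨(s.shortExact j).exact.desc k ?_, (s.shortExact j).exact.g_desc _ _⟩
    rw [s.d_eq, Category.assoc] at hk
    rw [← cancel_epi (s.p (j + 1)), comp_zero]
    exact hk
  exact ⟨(cokernelIsCokernel (K.d (j + 1) j)).coconePointUniqueUpToIso hl⟩

omit s in
lemma isHomExact_iff (𝓑 : ObjectProperty 𝒜) (K : ChainComplex 𝒜 ℤ) :
    IsHomExact 𝓑 K ↔ ∀ B : 𝒜, 𝓑 B → ∀ j : ℤ,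
      Function.Exact (fun h : K.X j ⟶ B => K.d (j + 1) j ≫ h)
        (fun g : K.X (j + 1) ⟶ B => K.d (j + 1 + 1) (j + 1) ≫ g) := by
  refine forall_congr' fun B => forall_congr' fun hB => ⟨fun h j => ?_, fun h j => ?_⟩
  · have := h (j + 1)
    obtain ⟨m, hm⟩ : ∃ m, m = j + 1 - 1 := ⟨_, rfl⟩
    obtain rfl : m = j := by omega
    rwa [← hm] at this
  · obtain ⟨m, hm⟩ : ∃ m, m = j - 1 := ⟨_, rfl⟩
    obtain rfl : m + 1 = j := by omega
    rw [← hm]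
    exact h m

/-- A map `K.X (j + 1) ⟶ B` killed by the incoming differential is the same as a map out of `X (j +
1)`. It is a boundary exactly when that map extends along `s.i j`. -/
lemma isHomExact_iff_exists_extension (𝓑 : ObjectProperty 𝒜) :
    IsHomExact 𝓑 K ↔ ∀ B : 𝒜, 𝓑 B → ∀ (j : ℤ) (a : X (j + 1) ⟶ B),
      ∃ b : K.X j ⟶ B, s.i j ≫ b = a := by
  have := s.epi_p
  rw [isHomExact_iff]
  refine forall_congr' fun B => forall_congr' fun hB => forall_congr' fun j =>
    ⟨fun h a => ?_, fun h g => ⟨fun hg => ?_, ?_⟩⟩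
  · obtain ⟨b, hb⟩ := (h (s.p (j + 1) ≫ a)).1 (by
      change K.d _ _ ≫ s.p _ ≫ a = 0
      rw [s.d_eq, Category.assoc, reassoc_of% (s.zero (j + 1)), zero_comp, comp_zero])
    refine ⟨b, ?_⟩
    rw [← cancel_epi (s.p (j + 1)), ← hb]
    simp [s.d_eq]
  · change K.d _ _ ≫ g = 0 at hg
    rw [s.d_eq, Category.assoc] at hg
    have hg' : s.i (j + 1) ≫ g = 0 := by
      rw [← cancel_epi (s.p (j + 1 + 1)), hg, comp_zero]
    obtain ⟨b, hb⟩ := h ((s.shortExact (j + 1)).exact.desc g hg')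
    refine ⟨b, ?_⟩
    change K.d _ _ ≫ b = g
    rw [s.d_eq, Category.assoc, hb]
    exact (s.shortExact (j + 1)).exact.g_desc g hg'
  · rintro ⟨b, rfl⟩
    exact K.d_comp_d_assoc _ _ _ _ |>.trans zero_comp

end Splicing

/-- An acyclic complex is spliced together from its opcycles. -/
noncomputable def Splicing.ofAcyclic (K : ChainComplex 𝒜 ℤ) (hK : K.Acyclic) :
    Splicing K (fun j => K.opcycles j) where
  i j := K.fromOpcycles (j + 1) j
  p j := K.pOpcycles j
  zero j := by rw [← cancel_epi (K.pOpcycles (j + 1)), K.p_fromOpcycles_assoc, K.d_pOpcycles,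
    comp_zero]
  shortExact j :=
    { exact := by
        have h := ShortComplex.exact_of_g_is_cokernel
          (ShortComplex.mk _ _ (K.d_pOpcycles (j + 1) j))
          (K.opcyclesIsCokernel (j + 1) j (by simp))
        let φ : ShortComplex.mk _ _ (K.d_pOpcycles (j + 1) j) ⟶
            ShortComplex.mk (K.fromOpcycles (j + 1) j) (K.pOpcycles j) (by
              rw [← cancel_epi (K.pOpcycles (j + 1)), K.p_fromOpcycles_assoc, K.d_pOpcycles,
                comp_zero]) :=
          { τ₁ := K.pOpcycles (j + 1), τ₂ := 𝟙 _, τ₃ := 𝟙 _ }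
        have : Epi φ.τ₁ := inferInstanceAs (Epi (K.pOpcycles (j + 1)))
        have : IsIso φ.τ₂ := inferInstanceAs (IsIso (𝟙 _))
        have : Mono φ.τ₃ := inferInstanceAs (Mono (𝟙 _))
        exact (ShortComplex.exact_iff_of_epi_of_isIso_of_mono φ).1 h
      mono_f := by
        have hz : IsZero (K.homology (j + 1)) := (hK (j + 1)).isZero_homology
        exact Preadditive.mono_of_isZero_kernel' _
          (K.homologyIsKernel (j + 1) j (by simp)) hz
      epi_g := (inferInstance : Epi (K.pOpcycles j)) }
  d_eq j := (K.p_fromOpcycles (j + 1) j).symm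

end Splicing

/-! ### Classes of modules and of complexes. -/

section ModuleClasses

variable {R : Type u} [CommRing R]

lemma shortExact_mk_iff {A B D : ModuleCat.{u} R} {f : A ⟶ B} {g : B ⟶ D} (w : f ≫ g = 0) :
    (ShortComplex.mk f g w).ShortExact ↔
      Function.Injective f ∧ Function.Exact f g ∧ Function.Surjective g := by
  refine ⟨fun h => ⟨h.moduleCat_injective_f,
    (ShortComplex.ShortExact.moduleCat_exact_iff_function_exact _).1 h.exact,
    h.moduleCat_surjective_g⟩, fun h => ?_⟩
  exact
    { exact := (ShortComplex.ShortExact.moduleCat_exact_iff_function_exact _).2 h.2.1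
      mono_f := (ModuleCat.mono_iff_injective _).2 h.1
      epi_g := (ModuleCat.epi_iff_surjective _).2 h.2.2 }

instance : (projectiveModules R).IsClosedUnderIsomorphisms where
  of_iso e h := by
    have : Module.Projective R _ := h
    exact Module.Projective.of_equiv e.toLinearEquiv

instance (C : ModuleCat.{u} R) : (cProjectiveModules C).IsClosedUnderIsomorphisms where
  of_iso e := by
    rintro ⟨P, hP, ⟨f⟩⟩
    exact ⟨P, hP, ⟨e.toLinearEquiv.symm.trans f⟩⟩

instance (C : ModuleCat.{u} R) : (cFlatModules C).IsClosedUnderIsomorphisms where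
  of_iso e := by
    rintro ⟨P, hP, ⟨f⟩⟩
    exact ⟨P, hP, ⟨e.toLinearEquiv.symm.trans f⟩⟩

lemma cProjectiveModules_le_cFlatModules (C : ModuleCat.{u} R) :
    cProjectiveModules C ≤ cFlatModules C := by
  rintro M ⟨P, hP, e⟩
  exact ⟨P, inferInstance, e⟩

lemma tildeClass_mono {𝒳 𝒴 : ObjectProperty (ModuleCat.{u} R)} (h : 𝒳 ≤ 𝒴) :
    tildeClass 𝒳 ≤ tildeClass 𝒴 :=
  fun _ hK => ⟨hK.1, fun i => h _ (hK.2 i)⟩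

variable (𝒳 : ObjectProperty (ModuleCat.{u} R)) [𝒳.IsClosedUnderIsomorphisms]

lemma Splicing.tildeClass {K : ChainComplex (ModuleCat.{u} R) ℤ} {X : ℤ → ModuleCat.{u} R}
    (s : Splicing K X) (hX : ∀ j, 𝒳 (X j)) : tildeClass 𝒳 K :=
  ⟨s.acyclic, fun j => 𝒳.prop_of_iso (s.cyclesIso j).symm (hX (j + 1))⟩

lemma prop_opcycles_of_tildeClass {K : ChainComplex (ModuleCat.{u} R) ℤ}
    (hK : DingC.tildeClass 𝒳 K) (j : ℤ) : 𝒳 (K.opcycles j) := by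
  obtain ⟨k, rfl⟩ : ∃ k, k + 1 = j := ⟨j - 1, by ring⟩
  exact 𝒳.prop_of_iso ((Splicing.ofAcyclic K hK.1).cyclesIso k) (hK.2 k)

end ModuleClasses

/-! ### Sums of disks, and Ext of complexes. -/

section Disk

variable {R : Type u} [CommRing R]

/-- The contractible complex with `M (j + 1) × M j` in degree `j`, i.e. the direct sum of the
disks on the modules `M j`. -/
noncomputable def disk (M : ℤ → ModuleCat.{u} R) : ChainComplex (ModuleCat.{u} R) ℤ :=
  splice (X := M) (E := fun j => ModuleCat.of R (M (j + 1) × M j))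
    (fun j => ModuleCat.ofHom (LinearMap.inl R (M (j + 1)) (M j)))
    (fun j => ModuleCat.ofHom (LinearMap.snd R (M (j + 1)) (M j)))
    (fun _ => by ext x; rfl)

variable (M : ℤ → ModuleCat.{u} R)

/-- The defining splicing of a sum of disks. -/
noncomputable def diskSplicing : Splicing (disk M) M :=
  spliceSplicing _ _ _ (fun _ => (shortExact_mk_iff _).2
    ⟨LinearMap.inl_injective, Function.Exact.inl_snd, Prod.snd_surjective⟩)

lemma tildeClass_disk (𝒳 : ObjectProperty (ModuleCat.{u} R)) [𝒳.IsClosedUnderIsomorphisms]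
    (h : ∀ j, 𝒳 (M j)) : tildeClass 𝒳 (disk M) :=
  (diskSplicing M).tildeClass 𝒳 h

lemma disk_d (j : ℤ) : (disk M).d (j + 1) j =
    ModuleCat.ofHom (LinearMap.inl R (M (j + 1)) (M j) ∘ₗ
      LinearMap.snd R (M (j + 1 + 1)) (M (j + 1))) :=
  (diskSplicing M).d_eq j

/-- The inclusion of the generators in degree `j`. -/
def diskInr (j : ℤ) : M j ⟶ (disk M).X j :=
  ModuleCat.ofHom (LinearMap.inr R (M (j + 1)) (M j))

variable {M}

/-- A chain map out of a sum of disks is determined by maps on generators. -/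
noncomputable def diskDesc {Y : ChainComplex (ModuleCat.{u} R) ℤ} (φ : ∀ j, M j ⟶ Y.X j) :
    disk M ⟶ Y where
  f j := ModuleCat.ofHom (LinearMap.coprod (φ (j + 1) ≫ Y.d (j + 1) j).hom (φ j).hom)
  comm' i j hij := by
    obtain rfl : j + 1 = i := hij
    rw [disk_d]
    ext x
    have h : Y.d (j + 1) j (Y.d (j + 1 + 1) (j + 1) (φ _ x.1)) = 0 := by
      rw [← ModuleCat.comp_apply, Y.d_comp_d]; rfl
    change Y.d (j + 1) j (Y.d (j + 1 + 1) (j + 1) (φ _ x.1) + φ _ x.2) =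
      Y.d (j + 1) j (φ _ x.2) + φ _ 0
    rw [map_add, h, map_zero, zero_add, add_zero]

lemma diskDesc_f_apply {Y : ChainComplex (ModuleCat.{u} R) ℤ} (φ : ∀ j, M j ⟶ Y.X j) (j : ℤ)
    (x : M (j + 1) × M j) :
    (diskDesc φ).f j x = Y.d (j + 1) j (φ (j + 1) x.1) + φ j x.2 := rfl

lemma diskInr_diskDesc {Y : ChainComplex (ModuleCat.{u} R) ℤ} (φ : ∀ j, M j ⟶ Y.X j) (j : ℤ) :
    diskInr M j ≫ (diskDesc φ).f j = φ j := by
  ext x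
  change (diskDesc φ).f j ((0, x) : M (j + 1) × M j) = _
  rw [diskDesc_f_apply, map_zero, map_zero, zero_add]

lemma disk_hom_ext {Y : ChainComplex (ModuleCat.{u} R) ℤ} {f g : disk M ⟶ Y}
    (h : ∀ j, diskInr M j ≫ f.f j = diskInr M j ≫ g.f j) : f = g := by
  have key (k : disk M ⟶ Y) : k = diskDesc (fun j => diskInr M j ≫ k.f j) := by
    ext j x
    -- Every element is a generator plus the boundary of a generator.
    have hx : x = (disk M).d (j + 1) j (diskInr M (j + 1) (x : M (j + 1) × M j).1) +
        diskInr M j (x : M (j + 1) × M j).2 := by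
      rw [disk_d]
      exact Prod.ext (add_zero _).symm (zero_add _).symm
    change _ = Y.d (j + 1) j (k.f (j + 1) (diskInr M (j + 1) _)) + k.f j (diskInr M j _)
    conv_lhs => rw [hx, map_add]
    congr 1
    rw [← ModuleCat.comp_apply, ← k.comm, ModuleCat.comp_apply]
    rfl
  rw [key f, key g]
  congr 1
  funext j
  exact h j

/-- The functoriality of `disk`. -/
noncomputable def diskMap {N : ℤ → ModuleCat.{u} R} (f : ∀ j, M j ⟶ N j) : disk M ⟶ disk N :=
  diskDesc (fun j => f j ≫ diskInr N j)

lemma diskMap_f_apply {N : ℤ → ModuleCat.{u} R} (f : ∀ j, M j ⟶ N j) (j : ℤ)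
    (x : M (j + 1) × M j) :
    (diskMap f).f j x = ((f (j + 1) x.1, f j x.2) : N (j + 1) × N j) := by
  have : (diskMap f).f j x = (disk N).d (j + 1) j (diskInr N (j + 1) (f (j + 1) x.1)) +
    diskInr N j (f j x.2) := rfl
  rw [this, disk_d]
  exact Prod.ext (add_zero _) (zero_add _)

lemma diskMap_comp {N L : ℤ → ModuleCat.{u} R} (f : ∀ j, M j ⟶ N j) (g : ∀ j, N j ⟶ L j) :
    diskMap f ≫ diskMap g = diskMap (fun j => f j ≫ g j) := by
  ext j x
  change (diskMap g).f j ((diskMap f).f j x) = _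
  rw [diskMap_f_apply f j x, diskMap_f_apply g]
  exact (diskMap_f_apply (fun j => f j ≫ g j) j x).symm

variable (M) in
lemma diskMap_id : diskMap (fun j => 𝟙 (M j)) = 𝟙 (disk M) := by
  ext j x
  exact diskMap_f_apply (fun j => 𝟙 (M j)) j x

lemma diskMap_zero {N : ℤ → ModuleCat.{u} R} :
    diskMap (fun j => (0 : M j ⟶ N j)) = 0 := by
  ext j x
  exact diskMap_f_apply (fun j => (0 : M j ⟶ N j)) j x

lemma diskMap_comp_eq_zero {N L : ℤ → ModuleCat.{u} R} (f : ∀ j, M j ⟶ N j)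
    (g : ∀ j, N j ⟶ L j) (w : ∀ j, f j ≫ g j = 0) : diskMap f ≫ diskMap g = 0 := by
  rw [diskMap_comp, funext w]
  exact diskMap_zero

lemma disk_shortExact {N L : ℤ → ModuleCat.{u} R} (f : ∀ j, M j ⟶ N j)
    (g : ∀ j, N j ⟶ L j) (w : ∀ j, f j ≫ g j = 0)
    (hS : ∀ j, (ShortComplex.mk (f j) (g j) (w j)).ShortExact) :
    (ShortComplex.mk (diskMap f) (diskMap g) (diskMap_comp_eq_zero f g w)).ShortExact := by
  refine HomologicalComplex.shortExact_of_degreewise_shortExact _ fun j => ?_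
  obtain ⟨hf₁, hfg₁, hg₁⟩ := (shortExact_mk_iff _).1 (hS (j + 1))
  obtain ⟨hf₂, hfg₂, hg₂⟩ := (shortExact_mk_iff _).1 (hS j)
  have hf : ⇑((diskMap f).f j) = Prod.map (f (j + 1)) (f j) :=
    funext fun x => diskMap_f_apply f j x
  have hg : ⇑((diskMap g).f j) = Prod.map (g (j + 1)) (g j) :=
    funext fun x => diskMap_f_apply g j x
  refine (shortExact_mk_iff (f := (diskMap f).f j) (g := (diskMap g).f j) _).2 ⟨?_, ?_, ?_⟩
  · rw [hf]; exact hf₁.prodMap hf₂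
  · rw [hf, hg]
    intro x
    change Prod.map (g (j + 1)) (g j) x = ((0 : L (j + 1)), (0 : L j)) ↔ _
    rw [Prod.ext_iff]
    constructor
    · rintro ⟨h₁, h₂⟩
      obtain ⟨y₁, hy₁⟩ := (hfg₁ _).1 h₁
      obtain ⟨y₂, hy₂⟩ := (hfg₂ _).1 h₂
      exact ⟨(y₁, y₂), Prod.ext hy₁ hy₂⟩
    · rintro ⟨y, rfl⟩
      exact ⟨(hfg₁ _).2 ⟨_, rfl⟩, (hfg₂ _).2 ⟨_, rfl⟩⟩
  · rw [hg]; exact hg₁.prodMap hg₂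

lemma epi_diskDesc {Y : ChainComplex (ModuleCat.{u} R) ℤ} (φ : ∀ j, M j ⟶ Y.X j)
    [∀ j, Epi (φ j)] : Epi (diskDesc φ) := by
  have (j : ℤ) : Epi ((diskDesc φ).f j) :=
    epi_of_epi_fac (diskInr_diskDesc φ j)
  exact HomologicalComplex.epi_of_epi_f _ this

/-- Chain maps out of `disk M` are arbitrary families of maps on generators, so lifting is done
degree by degree. -/
instance projective_disk [∀ j, Projective (M j)] : Projective (disk M) where
  factors {A B} f e he := by
    have (j : ℤ) : Epi (e.f j) := inferInstance
    refine ⟨diskDesc (fun j => Projective.factorThru (diskInr M j ≫ f.f j) (e.f j)),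
      disk_hom_ext fun j => ?_⟩
    rw [HomologicalComplex.comp_f, ← Category.assoc, diskInr_diskDesc,
      Projective.factorThru_comp]

instance : EnoughProjectives (ChainComplex (ModuleCat.{u} R) ℤ) where
  presentation Y := ⟨
    { p := disk (fun j => Projective.over (Y.X j))
      f := diskDesc (fun j => Projective.π (Y.X j))
      epi := epi_diskDesc _ }⟩

instance : HasExt.{u} (ChainComplex (ModuleCat.{u} R) ℤ) :=
  hasExt_of_enoughProjectives _

lemma exists_shortExact_projectiveComplexes (Y : ChainComplex (ModuleCat.{u} R) ℤ) :
    ∃ (K P : ChainComplex (ModuleCat.{u} R) ℤ) (f : K ⟶ P) (g : P ⟶ Y) (w : f ≫ g = 0),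
      (ShortComplex.mk f g w).ShortExact ∧ projectiveComplexes R P ∧ Projective P := by
  have := epi_diskDesc (fun j => Projective.π (Y.X j))
  refine ⟨_, _, kernel.ι (diskDesc (fun j => Projective.π (Y.X j))), _, kernel.condition _,
    { exact := ShortComplex.exact_of_f_is_kernel _ (kernelIsKernel _) }, ?_, inferInstance⟩
  exact tildeClass_disk _ _ fun j =>
    (IsProjective.iff_projective (R := R) _).2 (inferInstanceAs (Projective (Projective.over _)))

/-- `Ext` out of a sum of disks is computed degreewise. -/
lemma extVanishes_disk {Y : ChainComplex (ModuleCat.{u} R) ℤ}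
    (h : ∀ j, ExtVanishes (M j) (Y.X j)) : ExtVanishes (disk M) Y := by
  -- Projective presentations of the modules `N j` assemble into a presentation of `disk N` whose
  -- kernel is again a disk with the same vanishing, so dimension shifting stays within this class.
  refine ExtVanishes.of_forall_exists_shortExact
    (fun X => ∃ N : ℤ → ModuleCat.{u} R, (∀ j, ExtVanishes (N j) (Y.X j)) ∧ X = disk N) Y
    ?_ ⟨M, h, rfl⟩
  rintro X ⟨N, hN, rfl⟩
  have hS (j : ℤ) : (ShortComplex.mk (kernel.ι (Projective.π (N j))) (Projective.π (N j))
      (kernel.condition _)).ShortExact :=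
    { exact := ShortComplex.exact_of_f_is_kernel _ (kernelIsKernel _) }
  refine ⟨_, _, _, _, _, disk_shortExact _ _ _ hS,
    ⟨_, fun j => ExtVanishes.of_shortExact₁ (hS j) (ExtVanishes.of_projective _ _) (hN j), rfl⟩,
    ExtVanishes.of_projective _ _, fun a => ?_⟩
  choose b hb using fun j => (hN j).exists_extension (hS j)
    (diskInr (fun j => kernel (Projective.π (N j))) j ≫ a.f j)
  refine ⟨diskDesc b, disk_hom_ext fun j => ?_⟩
  rw [HomologicalComplex.comp_f, ← Category.assoc]
  erw [diskInr_diskDesc]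
  rw [Category.assoc, diskInr_diskDesc]
  exact hb j

/-- A degreewise split acyclic complex is a sum of disks. -/
lemma Splicing.nonempty_iso_disk {K : ChainComplex (ModuleCat.{u} R) ℤ}
    (s : Splicing K M) (σ : ∀ j, M j ⟶ K.X j) (hσ : ∀ j, σ j ≫ s.p j = 𝟙 _) :
    Nonempty (K ≅ disk M) := by
  have hσ' (j : ℤ) (x : M j) : s.p j (σ j x) = x := by
    rw [← ModuleCat.comp_apply, hσ]; rfl
  have hd (j : ℤ) (x : M (j + 1)) : K.d (j + 1) j (σ (j + 1) x) = s.i j x := by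
    rw [s.d_eq, ModuleCat.comp_apply, hσ']
  have (j : ℤ) : IsIso ((diskDesc σ).f j) := by
    obtain ⟨hi, hip, -⟩ := (shortExact_mk_iff _).1 (s.shortExact j)
    have happ (x : M (j + 1) × M j) : (diskDesc σ).f j x = s.i j x.1 + σ j x.2 := by
      rw [diskDesc_f_apply, hd]
    have hp (x : M (j + 1) × M j) : s.p j ((diskDesc σ).f j x) = x.2 := by
      rw [happ, map_add, hσ', hip.apply_apply_eq_zero, zero_add]
    rw [ConcreteCategory.isIso_iff_bijective]
    constructor
    · rw [injective_iff_map_eq_zero]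
      intro (x : M (j + 1) × M j) hx
      have h₂ : x.2 = 0 := by rw [← hp x, hx, map_zero]
      have h₁ : x.1 = 0 := by
        apply hi
        rw [happ, h₂, map_zero, add_zero] at hx
        rw [hx, map_zero]
      exact Prod.ext h₁ h₂
    · intro y
      obtain ⟨a, ha⟩ := (hip (y - σ j (s.p j y))).1 (by rw [map_sub, hσ', sub_self])
      exact ⟨((a, s.p j y) : M (j + 1) × M j), by rw [happ, ha, sub_add_cancel]⟩
  have : IsIso (diskDesc σ) := HomologicalComplex.Hom.isIso_of_components _
  exact ⟨(asIso (diskDesc σ)).symm⟩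

/-- Vanishing of `Ext^1(M j, M (j + 1))` splits each of the short exact sequences. -/
lemma Splicing.nonempty_iso_disk_of_extVanishes {K : ChainComplex (ModuleCat.{u} R) ℤ}
    (s : Splicing K M) (h : ∀ j, ExtVanishes (M j) (M (j + 1))) : Nonempty (K ≅ disk M) := by
  choose r hr using fun j => (h j).exists_extension (s.shortExact j) (𝟙 (M (j + 1)))
  have hs (j : ℤ) := ShortComplex.Splitting.ofExactOfRetraction _ (s.shortExact j).exact (r j)
    (hr j) (s.epi_p j)
  exact s.nonempty_iso_disk (fun j => (hs j).s) (fun j => (hs j).s_g)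

end Disk

/-! ### Tensor evaluation and biduality. -/

section TensorHom

open TensorProduct

variable {R : Type u} [CommRing R] {A B D : Type u} [AddCommGroup A] [AddCommGroup B]
  [AddCommGroup D] [Module R A] [Module R B] [Module R D] (N F : Type u) [AddCommGroup N]
  [AddCommGroup F] [Module R N] [Module R F]

lemma rTensorHomToHomRTensor_lcomp (f : A →ₗ[R] B) (x : (B →ₗ[R] N) ⊗[R] F) :
    rTensorHomToHomRTensor (.id R) A N F ((LinearMap.lcomp R N f).rTensor F x) =
      rTensorHomToHomRTensor (.id R) B N F x ∘ₗ f := by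
  induction x with
  | zero => simp
  | add x y hx hy => simp only [map_add, hx, hy, LinearMap.add_comp]
  | tmul φ y => ext a; simp

variable (A) in
lemma rTensorHomToHomRTensor_bijective_of_projective [Module.Finite R A] [Module.Projective R A] :
    Function.Bijective (rTensorHomToHomRTensor (.id R) A N F) := by
  rw [← rTensorHomEquivHomRTensor_toLinearMap]
  exact (rTensorHomEquivHomRTensor R A N F).bijective

/-- By flatness `Hom(B, N) ⊗ F` embeds in `Hom(A, N) ⊗ F`, where tensor evaluation is an
isomorphism. -/
lemma rTensorHomToHomRTensor_injective [Module.Flat R F] [Module.Finite R A]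
    [Module.Projective R A] (g : A →ₗ[R] B) (hg : Function.Surjective g) :
    Function.Injective (rTensorHomToHomRTensor (.id R) B N F) := by
  rw [injective_iff_map_eq_zero]
  intro x hx
  have h₁ : Function.Injective ((LinearMap.lcomp R N g).rTensor F) :=
    Module.Flat.rTensor_preserves_injective_linearMap _
      (LinearMap.lcomp_injective_of_surjective g hg)
  apply h₁
  apply (rTensorHomToHomRTensor_bijective_of_projective A N F).1
  rw [rTensorHomToHomRTensor_lcomp, hx, map_zero, map_zero, LinearMap.zero_comp]

/-- A diagram chase: both functors are left exact in the first variable, and the evaluation map is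
bijective at `B` and injective at `A`. -/
lemma rTensorHomToHomRTensor_surjective [Module.Flat R F] [Module.Finite R B]
    [Module.Projective R B] {f : A →ₗ[R] B} {g : B →ₗ[R] D} (hfg : Function.Exact f g)
    (hg : Function.Surjective g)
    (hA : Function.Injective (rTensorHomToHomRTensor (.id R) A N F)) :
    Function.Surjective (rTensorHomToHomRTensor (.id R) D N F) := by
  intro k
  obtain ⟨y, hy⟩ := (rTensorHomToHomRTensor_bijective_of_projective B N F).2 (k ∘ₗ g)
  have hy₀ : (LinearMap.lcomp R N f).rTensor F y = 0 := by
    apply hA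
    rw [rTensorHomToHomRTensor_lcomp, hy, map_zero, LinearMap.comp_assoc,
      hfg.linearMap_comp_eq_zero, LinearMap.comp_zero]
  obtain ⟨z, rfl⟩ := (Module.Flat.rTensor_exact F
    (LinearMap.exact_lcomp_of_exact_of_surjective N hfg hg) y).1 hy₀
  refine ⟨z, ?_⟩
  rw [rTensorHomToHomRTensor_lcomp] at hy
  exact (LinearMap.cancel_right hg).1 hy

/-- Extension of homomorphisms along `f` is inherited by the tensor product with a projective
module. -/
lemma exists_extension_rTensor (f : A →ₗ[R] B) (P : Type u) [AddCommGroup P] [Module R P]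
    [Module.Projective R P] (h : ∀ a : A →ₗ[R] N, ∃ b : B →ₗ[R] N, b ∘ₗ f = a)
    (a : A ⊗[R] P →ₗ[R] N) : ∃ b : B ⊗[R] P →ₗ[R] N, b ∘ₗ f.rTensor P = a := by
  -- By adjunction `a` is a map `P → Hom(A, N)`, to be lifted through the surjection `Hom(B, N) →
  -- Hom(A, N)`.
  obtain ⟨k, hk⟩ := Module.projective_lifting_property (LinearMap.lcomp R N f)
    (TensorProduct.curry a).flip h
  refine ⟨TensorProduct.lift k.flip, TensorProduct.ext' fun x p => ?_⟩
  have := LinearMap.congr_fun (LinearMap.congr_fun hk p) x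
  simpa using this

lemma exists_dual_family (M : Type u) [AddCommGroup M] [Module R M] [Module.Finite R M]
    [Module.Projective R M] : ∃ (n : ℕ) (x : Fin n → M) (φ : Fin n → M →ₗ[R] R),
      ∀ m, ∑ k, φ k m • x k = m := by
  obtain ⟨n, f, g, -, -, h⟩ := Module.Finite.exists_comp_eq_id_of_projective R M
  refine ⟨n, fun k => f (Pi.single k 1), fun k => LinearMap.proj k ∘ₗ g, fun m => ?_⟩
  conv_rhs => rw [← LinearMap.id_apply (R := R) m, ← h, LinearMap.comp_apply,
    pi_eq_sum_univ' (g m), map_sum]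
  refine Finset.sum_congr rfl fun k _ => ?_
  rw [map_smul]
  congr 2

variable (R) in
/-- The biduality map `M ⊗ F → Hom(Hom(M, N), N ⊗ F)`. -/
def bidualMap (M : Type u) [AddCommGroup M] [Module R M] :
    M ⊗[R] F →ₗ[R] (M →ₗ[R] N) →ₗ[R] N ⊗[R] F :=
  (LinearMap.rTensorHom F).flip

lemma bidualMap_apply (M : Type u) [AddCommGroup M] [Module R M] (x : M ⊗[R] F)
    (φ : M →ₗ[R] N) : bidualMap R N F M x φ = φ.rTensor F x := rfl

lemma bidualMap_rTensor (f : A →ₗ[R] B) (x : A ⊗[R] F) (φ : B →ₗ[R] N) :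
    bidualMap R N F B (f.rTensor F x) φ = bidualMap R N F A x (φ ∘ₗ f) := by
  rw [bidualMap_apply, bidualMap_apply, LinearMap.rTensor_comp_apply]

/-- Since `Hom(N, N)` is generated by the identity, evaluation at the identity inverts the biduality
map. -/
lemma bidualMap_self_bijective (h : Function.Bijective (algebraMap R (Module.End R N))) :
    Function.Bijective (bidualMap R N F N) := by
  constructor
  · rw [injective_iff_map_eq_zero]
    intro x hx
    have := LinearMap.congr_fun hx LinearMap.id
    rwa [bidualMap_apply, LinearMap.rTensor_id_apply] at this
  · intro ψ
    refine ⟨ψ LinearMap.id, LinearMap.ext fun φ => ?_⟩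
    obtain ⟨r, rfl⟩ := h.2 φ
    have : algebraMap R (Module.End R N) r = r • (LinearMap.id : N →ₗ[R] N) :=
      Algebra.algebraMap_eq_smul_one r
    rw [this, map_smul, map_smul, bidualMap_apply, LinearMap.rTensor_id_apply]

/-- For flat `F` and `N` with bijective homothety map, `F ≅ Hom(N, N ⊗ F)`. -/
lemma mk_flip_bijective (h : Function.Bijective (algebraMap R (Module.End R N)))
    (hN : Function.Bijective (rTensorHomToHomRTensor (.id R) N N F)) :
    Function.Bijective (TensorProduct.mk R N F).flip := by
  let e : R ≃ₗ[R] (N →ₗ[R] N) :=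
    LinearEquiv.ofBijective (Algebra.linearMap R (Module.End R N)) h
  have he : (TensorProduct.mk R N F).flip = rTensorHomToHomRTensor (.id R) N N F ∘ₗ
      ((TensorProduct.lid R F).symm.trans (e.rTensor F)).toLinearMap := by
    ext y c
    have h₁ : e 1 = LinearMap.id := map_one (algebraMap R (Module.End R N))
    simp [h₁]
  rw [he, LinearMap.coe_comp]
  exact hN.comp (LinearEquiv.bijective _)

lemma bidualMap_bijective_of_projective
    (hF : Function.Bijective (TensorProduct.mk R N F).flip)
    (M : Type u) [AddCommGroup M] [Module R M] [Module.Finite R M]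
    [Module.Projective R M] : Function.Bijective (bidualMap R N F M) := by
  obtain ⟨n, x, φ, hφ⟩ := exists_dual_family (R := R) M
  constructor
  · rw [injective_iff_map_eq_zero]
    intro y hy
    -- The `k`-th coordinate of `y` is an element of `F`. Testing on `m ↦ φ k m • c` shows that `c
    -- ⊗` this coordinate vanishes for all `c`, which suffices by `hF`.
    have hk (k) : TensorProduct.lid R F ((φ k).rTensor F y) = 0 := by
      apply hF.1
      rw [map_zero]
      ext c
      have h₁ := LinearMap.congr_fun hy (LinearMap.toSpanSingleton R N c ∘ₗ φ k)
      rw [bidualMap_apply, LinearMap.rTensor_comp_apply] at h₁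
      have h₂ (z : R ⊗[R] F) : (LinearMap.toSpanSingleton R N c).rTensor F z =
          c ⊗ₜ[R] TensorProduct.lid R F z := by
        induction z with
        | zero => simp
        | add a b ha hb => simp only [map_add, ha, hb, TensorProduct.tmul_add]
        | tmul r f => simp [TensorProduct.smul_tmul]
      rw [h₂] at h₁
      exact h₁
    have hy' : y = ∑ k, x k ⊗ₜ[R] TensorProduct.lid R F ((φ k).rTensor F y) := by
      clear hk hy
      induction y with
      | zero => simp
      | add a b ha hb =>
        conv_lhs => rw [ha, hb]
        simp only [map_add, TensorProduct.tmul_add, Finset.sum_add_distrib]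
      | tmul m f =>
        conv_lhs => rw [← hφ m]
        simp [TensorProduct.sum_tmul, TensorProduct.smul_tmul]
    rw [hy']
    simp [hk]
  · intro ψ
    -- By `hF`, the map `c ↦ ψ (φ k (·) • c)` is `c ↦ c ⊗ f k` for some `f k`. These are the
    -- coordinates of the preimage.
    choose f hf using fun k =>
      hF.2 (ψ ∘ₗ LinearMap.smulRightₗ (φ k))
    refine ⟨∑ k, x k ⊗ₜ[R] f k, LinearMap.ext fun χ => ?_⟩
    have hk (k) : χ (x k) ⊗ₜ[R] f k = ψ ((φ k).smulRight (χ (x k))) :=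
      LinearMap.congr_fun (hf k) (χ (x k))
    rw [bidualMap_apply, map_sum]
    simp only [LinearMap.rTensor_tmul, hk]
    rw [← map_sum]
    congr 1
    ext m
    conv_rhs => rw [← hφ m]
    simp

/-- The injective composite `A ⊗ F → B ⊗ F → Hom(Hom(B, N), N ⊗ F)` factors through the biduality
map of `A`. -/
lemma bidualMap_injective_of_exact [Module.Flat R F] {i : A →ₗ[R] B}
    (hi : Function.Injective i) (hB : Function.Injective (bidualMap R N F B)) :
    Function.Injective (bidualMap R N F A) := by
  rw [injective_iff_map_eq_zero]
  intro x hx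
  apply Module.Flat.rTensor_preserves_injective_linearMap (M := F) i hi
  apply hB
  rw [map_zero, map_zero]
  ext φ
  rw [bidualMap_rTensor, hx]
  rfl

/-- Restricted along `Hom(B, N) → Hom(A, N)`, `ψ` is evaluation at some `y` in `B ⊗ F`. That `y`
dies in `D ⊗ F`, hence comes from `A ⊗ F`. By `h` the restriction loses no information about `ψ`. -/
lemma bidualMap_surjective_of_exact {i : A →ₗ[R] B} {p : B →ₗ[R] D}
    (hip : Function.Exact i p) (hp : Function.Surjective p)
    (h : ∀ a : A →ₗ[R] N, ∃ b : B →ₗ[R] N, b ∘ₗ i = a)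
    (hB : Function.Surjective (bidualMap R N F B)) (hD : Function.Injective (bidualMap R N F D)) :
    Function.Surjective (bidualMap R N F A) := by
  intro ψ
  obtain ⟨y, hy⟩ := hB (ψ ∘ₗ LinearMap.lcomp R N i)
  have hy₀ : p.rTensor F y = 0 := by
    apply hD
    rw [map_zero]
    ext φ
    rw [bidualMap_rTensor, hy]
    change ψ (φ ∘ₗ p ∘ₗ i) = 0
    rw [hip.linearMap_comp_eq_zero, LinearMap.comp_zero, map_zero]
  obtain ⟨x, rfl⟩ := (rTensor_exact F hip hp y).1 hy₀
  refine ⟨x, LinearMap.ext fun φ => ?_⟩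
  obtain ⟨b, rfl⟩ := h φ
  rw [← bidualMap_rTensor, hy]
  rfl

/-- By biduality `ψ` is evaluation at a tensor in `D ⊗ F`; a lift of it to `B ⊗ F` evaluates on all
of `Hom(B, N)`. -/
lemma exists_extension_lcomp {p : B →ₗ[R] D} (hp : Function.Surjective p)
    (hD : Function.Surjective (bidualMap R N F D)) (ψ : (D →ₗ[R] N) →ₗ[R] N ⊗[R] F) :
    ∃ χ : (B →ₗ[R] N) →ₗ[R] N ⊗[R] F, χ ∘ₗ LinearMap.lcomp R N p = ψ := by
  obtain ⟨x, rfl⟩ := hD ψ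
  obtain ⟨y, rfl⟩ := LinearMap.rTensor_surjective F hp x
  exact ⟨bidualMap R N F B y, LinearMap.ext fun φ => (bidualMap_rTensor N F p y φ).symm⟩

end TensorHom

/-! ### Syzygies of `C` and their duals. -/

section Syzygies

open TensorProduct

variable {R : Type u} [CommRing R]

/-- A resolution of `S 0` by finitely generated projective modules `L m`, with syzygies `S m`. -/
structure FiniteSyzygies (S L : ℕ → ModuleCat.{u} R) where
  i (m : ℕ) : S (m + 1) ⟶ L m
  p (m : ℕ) : L m ⟶ S m
  zero (m : ℕ) : i m ≫ p m = 0
  shortExact (m : ℕ) : (ShortComplex.mk (i m) (p m) (zero m)).ShortExact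
  finite (m : ℕ) : Module.Finite R (L m)
  projective (m : ℕ) : Module.Projective R (L m)

/-- The syzygies of a projective resolution. -/
noncomputable def syzygy {C : ModuleCat.{u} R} (P : ProjectiveResolution C) :
    ℕ → ModuleCat.{u} R
  | 0 => C
  -- By exactness this cokernel is the image of the differential into degree `m`.
  | m + 1 => P.complex.opcycles (m + 1)

/-- The short exact sequences of syzygies of a projective resolution. -/
noncomputable def finiteSyzygies {C : ModuleCat.{u} R} (P : ProjectiveResolution C)
    (hP : ∀ n, Module.Finite R (P.complex.X n)) :
    FiniteSyzygies (syzygy P) (fun m => P.complex.X m) where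
  i m := P.complex.fromOpcycles (m + 1) m
  p m := match m with
    | 0 => P.π.f 0
    | m + 1 => P.complex.pOpcycles (m + 1)
  zero m := by
    have key {X : ModuleCat.{u} R} (g : P.complex.X m ⟶ X) (w : P.complex.d (m + 1) m ≫ g = 0) :
        P.complex.fromOpcycles (m + 1) m ≫ g = 0 := by
      rw [← cancel_epi (P.complex.pOpcycles (m + 1)), P.complex.p_fromOpcycles_assoc, comp_zero, w]
    match m with
    | 0 => exact key _ P.complex_d_comp_π_f_zero
    | m + 1 => exact key _ (P.complex.d_pOpcycles _ _)
  shortExact m :=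
    { mono_f := Preadditive.mono_of_isZero_kernel' _
        (P.complex.homologyIsKernel (m + 1) m (by simp)) (P.complex_exactAt_succ m).isZero_homology
      epi_g := match m with
        | 0 => (inferInstance : Epi (P.π.f 0))
        | m + 1 => (inferInstance : Epi (P.complex.pOpcycles (m + 1)))
      exact := by
        have key {X : ModuleCat.{u} R} (g : P.complex.X m ⟶ X) (w : P.complex.d (m + 1) m ≫ g = 0)
            (hw : (ShortComplex.mk _ _ w).Exact) (w' : P.complex.fromOpcycles (m + 1) m ≫ g = 0) :
            (ShortComplex.mk _ _ w').Exact := by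
          let φ : ShortComplex.mk _ _ w ⟶ ShortComplex.mk _ _ w' :=
            { τ₁ := P.complex.pOpcycles (m + 1), τ₂ := 𝟙 _, τ₃ := 𝟙 _ }
          have : Epi φ.τ₁ := (inferInstance : Epi (P.complex.pOpcycles (m + 1)))
          have : IsIso φ.τ₂ := (inferInstance : IsIso (𝟙 _))
          have : Mono φ.τ₃ := (inferInstance : Mono (𝟙 _))
          exact (ShortComplex.exact_iff_of_epi_of_isIso_of_mono φ).1 hw
        match m with
        | 0 => exact key _ P.complex_d_comp_π_f_zero P.exact₀ _
        | m + 1 =>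
          refine key _ (P.complex.d_pOpcycles _ _) ?_ _
          exact ShortComplex.exact_of_g_is_cokernel _ (P.complex.opcyclesIsCokernel _ _ (by simp)) }
  finite := hP
  projective m := (IsProjective.iff_projective _).2 (P.projective m)

variable {S L : ℕ → ModuleCat.{u} R} (s : FiniteSyzygies S L)

namespace FiniteSyzygies

lemma injective_i (m : ℕ) : Function.Injective (s.i m).hom :=
  ((shortExact_mk_iff _).1 (s.shortExact m)).1

lemma exact_ip (m : ℕ) : Function.Exact (s.i m).hom (s.p m).hom :=
  ((shortExact_mk_iff _).1 (s.shortExact m)).2.1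

lemma surjective_p (m : ℕ) : Function.Surjective (s.p m).hom :=
  ((shortExact_mk_iff _).1 (s.shortExact m)).2.2

include s in
lemma rTensorHomToHomRTensor_bijective (m : ℕ) (N F : Type u) [AddCommGroup N] [AddCommGroup F]
    [Module R N] [Module R F] [Module.Flat R F] :
    Function.Bijective (rTensorHomToHomRTensor (.id R) (S m) N F) := by
  have := s.finite
  have := s.projective
  exact ⟨rTensorHomToHomRTensor_injective N F _ (s.surjective_p m),
    rTensorHomToHomRTensor_surjective N F (s.exact_ip m) (s.surjective_p m)
      (rTensorHomToHomRTensor_injective N F _ (s.surjective_p (m + 1)))⟩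

variable (hext : ExtVanishes (S 0) (S 0))

include s hext

lemma extVanishes (m : ℕ) : ExtVanishes (S m) (S 0) := by
  induction m with
  | zero => exact hext
  | succ m ih =>
    have := (IsProjective.iff_projective (R := R) (L m)).1 (s.projective m)
    exact ExtVanishes.of_shortExact₁ (s.shortExact m) (ExtVanishes.of_projective (L m) _) ih

lemma exists_extension (m : ℕ) (a : S (m + 1) →ₗ[R] S 0) :
    ∃ b : L m →ₗ[R] S 0, b ∘ₗ (s.i m).hom = a := by
  obtain ⟨b, hb⟩ := (s.extVanishes hext m).exists_extension (s.shortExact m) (ModuleCat.ofHom a)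
  exact ⟨b.hom, congrArg ModuleCat.Hom.hom hb⟩

/-- Tensor evaluation turns `a` into an element of `Hom(S (m + 1), S 0) ⊗ F`. The extension property
with values in `S 0` and right exactness of the tensor product lift it. -/
lemma exists_extension_tensor (F : Type u) [AddCommGroup F] [Module R F] [Module.Flat R F]
    (m : ℕ) (a : S (m + 1) →ₗ[R] S 0 ⊗[R] F) :
    ∃ b : L m →ₗ[R] S 0 ⊗[R] F, b ∘ₗ (s.i m).hom = a := by
  obtain ⟨x, rfl⟩ := (s.rTensorHomToHomRTensor_bijective (m + 1) (S 0) F).2 a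
  obtain ⟨y, rfl⟩ := LinearMap.rTensor_surjective F
    (g := LinearMap.lcomp R (S 0) (s.i m).hom) (s.exists_extension hext m) x
  exact ⟨_, (rTensorHomToHomRTensor_lcomp _ _ _ _).symm⟩

/-- `Ext^n(S m ⊗ P, C ⊗ F) = 0` for `P` projective and `F` flat, where `C = S 0`. -/
lemma extVanishes_tensor (P F : Type u) [AddCommGroup P] [Module R P] [Module.Projective R P]
    [AddCommGroup F] [Module R F] [Module.Flat R F] (m : ℕ) :
    ExtVanishes (ModuleCat.of R (S m ⊗[R] P)) (ModuleCat.of R (S 0 ⊗[R] F)) := by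
  refine ExtVanishes.of_forall_exists_shortExact
    (fun X => ∃ m, X = ModuleCat.of R (S m ⊗[R] P)) _ ?_ ⟨m, rfl⟩
  rintro X ⟨m, rfl⟩
  have := s.projective m
  have : Projective (ModuleCat.of R (L m ⊗[R] P)) :=
    (IsProjective.iff_projective (R := R) _).1 inferInstance
  refine ⟨ModuleCat.of R (S (m + 1) ⊗[R] P), ModuleCat.of R (L m ⊗[R] P),
    ModuleCat.ofHom ((s.i m).hom.rTensor P), ModuleCat.ofHom ((s.p m).hom.rTensor P), ?_,
    (shortExact_mk_iff _).2 ⟨?_, ?_, ?_⟩, ⟨m + 1, rfl⟩, ExtVanishes.of_projective _ _,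
    fun a => ?_⟩
  · ext : 1
    exact (Module.Flat.rTensor_exact P (s.exact_ip m)).linearMap_comp_eq_zero
  · exact Module.Flat.rTensor_preserves_injective_linearMap _ (s.injective_i m)
  · exact Module.Flat.rTensor_exact P (s.exact_ip m)
  · exact LinearMap.rTensor_surjective P (s.surjective_p m)
  · obtain ⟨b, hb⟩ := exists_extension_rTensor _ (s.i m).hom P
      (s.exists_extension_tensor hext F m) a.hom
    exact ⟨ModuleCat.ofHom b, ModuleCat.hom_ext hb⟩

variable (hhom : Function.Bijective (algebraMap R (Module.End R (S 0))))

include hhom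

/-- Induction on syzygies from `S 0`, where the homothety isomorphism applies. Injectivity at `S m`
is what gives surjectivity at `S (m + 1)`. -/
lemma bidualMap_bijective (F : Type u) [AddCommGroup F] [Module R F] [Module.Flat R F] (m : ℕ) :
    Function.Bijective (bidualMap R (S 0) F (S m)) := by
  have := s.finite
  have := s.projective
  have hL (m : ℕ) : Function.Bijective (bidualMap R (S 0) F (L m)) :=
    bidualMap_bijective_of_projective _ _
      (mk_flip_bijective _ _ hhom (s.rTensorHomToHomRTensor_bijective 0 _ _)) _
  induction m with
  | zero => exact bidualMap_self_bijective _ _ hhom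
  | succ m ih =>
    exact ⟨bidualMap_injective_of_exact _ _ (s.injective_i m) (hL m).1,
      bidualMap_surjective_of_exact _ _ (s.exact_ip m) (s.surjective_p m)
        (s.exists_extension hext m) (hL m).2 ih.1⟩

omit hhom in
lemma dual_shortExact (P : Type u) [AddCommGroup P] [Module R P] [Module.Projective R P]
    (m : ℕ) : ∃ w, (ShortComplex.mk
      (ModuleCat.ofHom ((LinearMap.lcomp R (S 0) (s.p m).hom).rTensor P))
      (ModuleCat.ofHom ((LinearMap.lcomp R (S 0) (s.i m).hom).rTensor P)) w).ShortExact := by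
  have h := Module.Flat.rTensor_exact P
    (LinearMap.exact_lcomp_of_exact_of_surjective (S 0) (s.exact_ip m) (s.surjective_p m))
  refine ⟨ModuleCat.hom_ext h.linearMap_comp_eq_zero, (shortExact_mk_iff _).2 ⟨?_, h, ?_⟩⟩
  · exact Module.Flat.rTensor_preserves_injective_linearMap _
      (LinearMap.lcomp_injective_of_surjective _ (s.surjective_p m))
  · exact LinearMap.rTensor_surjective P (s.exists_extension hext m)

omit hhom hext in
-- For `L m` finitely generated projective, `Hom(L m, C) ≅ C ⊗ Hom(L m, R)`.
lemma cProjectiveModules_dual_tensor (P : Type u) [AddCommGroup P] [Module R P]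
    [Module.Projective R P] (m : ℕ) :
    cProjectiveModules (S 0) (ModuleCat.of R ((L m →ₗ[R] S 0) ⊗[R] P)) := by
  have := s.finite
  have := s.projective
  let e : (L m →ₗ[R] S 0) ≃ₗ[R] S 0 ⊗[R] (L m →ₗ[R] R) :=
    ((LinearEquiv.refl R (L m)).arrowCongr (TensorProduct.lid R (S 0)).symm).trans
      ((rTensorHomEquivHomRTensor R (L m) R (S 0)).symm.trans (TensorProduct.comm R _ _))
  have : Module.Projective R (L m →ₗ[R] R) :=
    inferInstanceAs (Module.Projective R (Module.Dual R (L m)))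
  exact ⟨ModuleCat.of R ((L m →ₗ[R] R) ⊗[R] P),
    (inferInstance : Module.Projective R ((L m →ₗ[R] R) ⊗[R] P)),
    ⟨(e.rTensor P).trans (TensorProduct.assoc R _ _ _)⟩⟩

/-- `Ext^n(Hom(S m, C) ⊗ P, C ⊗ F) = 0` for `P` projective and `F` flat, where `C = S 0`. -/
lemma extVanishes_dual_tensor (P F : Type u) [AddCommGroup P] [Module R P]
    [Module.Projective R P] [AddCommGroup F] [Module R F] [Module.Flat R F] (m : ℕ) :
    ExtVanishes (ModuleCat.of R ((S m →ₗ[R] S 0) ⊗[R] P)) (ModuleCat.of R (S 0 ⊗[R] F)) := by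
  induction m with
  | zero =>
    let e : R ≃ₗ[R] (S 0 →ₗ[R] S 0) :=
      LinearEquiv.ofBijective (Algebra.linearMap R (Module.End R (S 0))) hhom
    have : Module.Projective R (S 0 →ₗ[R] S 0) := Module.Projective.of_equiv e
    have : Projective (ModuleCat.of R ((S 0 →ₗ[R] S 0) ⊗[R] P)) :=
      (IsProjective.iff_projective (R := R) _).1 inferInstance
    exact ExtVanishes.of_projective _ _
  | succ m ih =>
    obtain ⟨w, hw⟩ := s.dual_shortExact hext P m
    obtain ⟨Q, hQ, ⟨e⟩⟩ := s.cProjectiveModules_dual_tensor P m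
    -- The middle term `Hom(L m, C) ⊗ P` is `C`-projective, hence orthogonal; the remaining
    -- extension property is biduality for `S m`.
    refine ExtVanishes.of_shortExact₃ hw ih
      ((s.extVanishes_tensor hext Q F 0).of_iso_left e.toModuleIso.symm) fun a => ?_
    obtain ⟨b, hb⟩ := exists_extension_rTensor _ (LinearMap.lcomp R (S 0) (s.p m).hom) P
      (exists_extension_lcomp (S 0) F (s.surjective_p m) (s.bidualMap_bijective hext hhom F m).2)
      a.hom
    exact ⟨ModuleCat.ofHom b, ModuleCat.hom_ext hb⟩

end FiniteSyzygies

variable {C : ModuleCat.{u} R}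

lemma IsSemidualizing.extVanishes_self (hC : IsSemidualizing C) : ExtVanishes C C :=
  fun n _ => (hC.ext_eq_zero (n + 1) (by omega)).elim _ _

lemma IsSemidualizing.exists_finiteSyzygies (hC : IsSemidualizing C) :
    ∃ S L : ℕ → ModuleCat.{u} R, S 0 = C ∧ Nonempty (FiniteSyzygies S L) := by
  obtain ⟨P, hP⟩ := hC.exists_resolution
  exact ⟨_, _, rfl, ⟨finiteSyzygies P hP⟩⟩

/-- `Ext^n(M, N) = 0` for `M` a `C`-projective and `N` a `C`-flat module. -/
lemma IsSemidualizing.extVanishes (hC : IsSemidualizing C) {M N : ModuleCat.{u} R}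
    (hM : cProjectiveModules C M) (hN : cFlatModules C N) : ExtVanishes M N := by
  obtain ⟨S, L, rfl, ⟨s⟩⟩ := hC.exists_finiteSyzygies
  obtain ⟨P, hP, ⟨e⟩⟩ := hM
  obtain ⟨F, hF, ⟨f⟩⟩ := hN
  exact ((s.extVanishes_tensor hC.extVanishes_self P F 0).of_iso_left
    e.toModuleIso.symm).of_iso_right f.toModuleIso.symm

/-- A projective module has a coresolution by `C`-projective modules whose cosyzygies are
`Ext`-orthogonal to the `C`-flat modules. -/
lemma IsSemidualizing.exists_coresolution (hC : IsSemidualizing C) (P : ModuleCat.{u} R)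
    (hP : Module.Projective R P) :
    ∃ (T Q : ℕ → ModuleCat.{u} R) (f : ∀ m, T m ⟶ Q m) (g : ∀ m, Q m ⟶ T (m + 1))
      (w : ∀ m, f m ≫ g m = 0), Nonempty (P ≅ T 0) ∧
      (∀ m, (ShortComplex.mk (f m) (g m) (w m)).ShortExact) ∧
      (∀ m, cProjectiveModules C (Q m)) ∧
      ∀ m N, cFlatModules C N → ExtVanishes (T m) N := by
  obtain ⟨S, L, rfl, ⟨s⟩⟩ := hC.exists_finiteSyzygies
  choose w hw using s.dual_shortExact hC.extVanishes_self P
  let e : R ≃ₗ[R] (S 0 →ₗ[R] S 0) :=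
    LinearEquiv.ofBijective (Algebra.linearMap R (Module.End R (S 0))) hC.homothety_bijective
  refine ⟨fun m => ModuleCat.of R ((S m →ₗ[R] S 0) ⊗[R] P),
    fun m => ModuleCat.of R ((L m →ₗ[R] S 0) ⊗[R] P), _, _, w,
    ⟨((TensorProduct.lid R P).symm.trans (e.rTensor P)).toModuleIso⟩, hw,
    s.cProjectiveModules_dual_tensor P, ?_⟩
  rintro m N ⟨F, hF, ⟨f⟩⟩
  exact (s.extVanishes_dual_tensor hC.extVanishes_self hC.homothety_bijective P F m).of_iso_right
    f.toModuleIso.symm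

end Syzygies

/-! ### Cokernels of composites and the horseshoe. -/

section DiagramLemmas

universe v w

variable {𝒜 : Type w} [Category.{v} 𝒜] [Abelian 𝒜]

/-- The cokernels of composable monomorphisms form a short exact sequence. -/
lemma exists_shortExact_cokernel_comp {X Y Z : 𝒜} (f : X ⟶ Y) (g : Y ⟶ Z) [Mono g] :
    ∃ (a : cokernel f ⟶ cokernel (f ≫ g)) (b : cokernel (f ≫ g) ⟶ cokernel g) (w : a ≫ b = 0),
      (ShortComplex.mk a b w).ShortExact := by
  have h := kernelCokernelCompSequence_exact f g
  have h₁ := (h.exact 2)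
  have h₂ := (h.exact 3)
  have hz : IsZero (kernel g) := isZero_kernel_of_mono g
  refine ⟨cokernel.map f (f ≫ g) (𝟙 _) g (by simp), cokernel.map (f ≫ g) g f (𝟙 _) (by simp), ?_,
    { exact := h₂
      mono_f := ?_
      epi_g := ?_ }⟩
  · exact (h.toIsComplex.zero 3)
  · exact h₁.mono_g (hz.eq_of_src _ _)
  · exact epi_of_epi_fac (cokernel.π_desc (f ≫ g) (𝟙 Z ≫ cokernel.π g) _)

/-- The object part of the horseshoe construction. -/
lemma exists_horseshoe {A B D QA QD A' D' : 𝒜} {f : A ⟶ B} {g : B ⟶ D} {w : f ≫ g = 0}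
    (hS : (ShortComplex.mk f g w).ShortExact) {a : A ⟶ QA} {π : QA ⟶ A'} {wa : a ≫ π = 0}
    (ha : (ShortComplex.mk a π wa).ShortExact) {d : D ⟶ QD} {ρ : QD ⟶ D'} {wd : d ≫ ρ = 0}
    (hd : (ShortComplex.mk d ρ wd).ShortExact) (u : B ⟶ QA) (hu : f ≫ u = a) :
    ∃ (B' A'' D'' : 𝒜) (m : B ⟶ QA ⊞ QD) (n : QA ⊞ QD ⟶ B') (wm : m ≫ n = 0)
      (x : A'' ⟶ B') (y : B' ⟶ D'') (wx : x ≫ y = 0),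
      (ShortComplex.mk m n wm).ShortExact ∧ (ShortComplex.mk x y wx).ShortExact ∧
        Nonempty (A'' ≅ A') ∧ Nonempty (D'' ≅ D') := by
  have : Mono f := hS.mono_f
  have : Mono a := ha.mono_f
  have : Mono d := hd.mono_f
  have : Epi g := hS.epi_g
  -- The embedding of `B` is factored as `m₁ ≫ m₂`, with cokernels `A'` and `D'`; the cokernel of
  -- the composite is then an extension of the second by the first.
  let m₁ : B ⟶ QA ⊞ D := biprod.lift u g
  let m₂ : QA ⊞ D ⟶ QA ⊞ QD := biprod.map (𝟙 QA) d
  have hm₁ : Mono m₁ := by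
    refine Preadditive.mono_of_cancel_zero _ fun {T} k hk => ?_
    have h₁ : k ≫ u = 0 := by simpa [m₁] using hk =≫ biprod.fst
    have h₂ : k ≫ g = 0 := by simpa [m₁] using hk =≫ biprod.snd
    obtain ⟨l, hl⟩ : ∃ l, l ≫ f = k := ⟨_, hS.exact.lift_f k h₂⟩
    rw [← hl, Category.assoc, hu] at h₁
    rw [← hl, (cancel_mono a).1 (h₁.trans zero_comp.symm), zero_comp]
  -- As `u ≫ π` kills `A`, it descends to `D`. The quotient map `(π, -t)` then kills the image of
  -- `m₁`.
  obtain ⟨t, ht⟩ : ∃ t : D ⟶ A', g ≫ t = u ≫ π :=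
    ⟨_, hS.exact.g_desc (u ≫ π) (by
      change f ≫ u ≫ π = 0
      rw [reassoc_of% hu, wa])⟩
  have hc₁ : Nonempty (cokernel m₁ ≅ A') := by
    have w₁ : m₁ ≫ biprod.desc π (-t) = 0 := by simp [m₁, ht]
    refine ⟨(cokernelIsCokernel m₁).coconePointUniqueUpToIso
      (t := CokernelCofork.ofπ _ w₁) ?_⟩
    have : Epi π := ha.epi_g
    have : Epi (biprod.desc π (-t)) := epi_of_epi_fac (biprod.inl_desc π (-t))
    refine CokernelCofork.IsColimit.ofπ' _ _ fun {T} k hk =>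
      Classical.indefiniteDescription _ ?_
    have hak : a ≫ biprod.inl ≫ k = 0 := by
      have : f ≫ m₁ = a ≫ biprod.inl := by
        ext <;> simp [m₁, hu, w]
      rw [← reassoc_of% this, hk, comp_zero]
    obtain ⟨l, hl⟩ : ∃ l, π ≫ l = biprod.inl ≫ k := ⟨_, ha.exact.g_desc _ hak⟩
    refine ⟨l, biprod.hom_ext' _ _ (by simpa using hl) ?_⟩
    rw [← cancel_epi g]
    have hk' : u ≫ biprod.inl ≫ k + g ≫ biprod.inr ≫ k = 0 := by
      rw [← hk]
      simp [m₁, biprod.lift_eq]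
    simp only [biprod.inr_desc_assoc, Preadditive.neg_comp, Preadditive.comp_neg,
      reassoc_of% ht, hl]
    exact (eq_neg_of_add_eq_zero_right hk').symm
  have hc₂ : Nonempty (cokernel m₂ ≅ D') := by
    have w₂ : m₂ ≫ biprod.snd ≫ ρ = 0 := by simp [m₂, wd]
    refine ⟨(cokernelIsCokernel m₂).coconePointUniqueUpToIso
      (t := CokernelCofork.ofπ _ w₂) ?_⟩
    have : Epi ρ := hd.epi_g
    have : Epi (biprod.snd (X := QA) ≫ ρ) := epi_comp _ _
    refine CokernelCofork.IsColimit.ofπ' _ _ fun {T} k hk =>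
      Classical.indefiniteDescription _ ?_
    have h₁ : biprod.inl ≫ k = 0 := by simpa [m₂] using biprod.inl ≫= hk
    have h₂ : d ≫ biprod.inr ≫ k = 0 := by simpa [m₂] using biprod.inr ≫= hk
    obtain ⟨l, hl⟩ : ∃ l, ρ ≫ l = biprod.inr ≫ k := ⟨_, hd.exact.g_desc _ h₂⟩
    exact ⟨l, biprod.hom_ext' _ _ (by simp [h₁]) (by simpa using hl)⟩
  obtain ⟨x, y, wx, hxy⟩ := exists_shortExact_cokernel_comp m₁ m₂
  exact ⟨_, _, _, m₁ ≫ m₂, cokernel.π _, cokernel.condition _, x, y, wx,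
    { exact := ShortComplex.exact_of_g_is_cokernel _ (cokernelIsCokernel _)
      mono_f := mono_comp _ _ }, hxy, hc₁, hc₂⟩

lemma nonempty_cokernel_iso {S : ShortComplex 𝒜} (hS : S.ShortExact) :
    Nonempty (cokernel S.f ≅ S.X₃) :=
  have := hS.epi_g
  ⟨(cokernelIsCokernel S.f).coconePointUniqueUpToIso hS.exact.gIsCokernel⟩

end DiagramLemmas

/-! ### Structure and orthogonality of projective and `C`-projective complexes. -/

section Classes

variable {R : Type u} [CommRing R]

instance (𝒳 : ObjectProperty (ModuleCat.{u} R)) [𝒳.IsClosedUnderIsomorphisms] :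
    (tildeClass 𝒳).IsClosedUnderIsomorphisms where
  of_iso e h := ⟨fun i => (h.1 i).of_iso e, fun i =>
    𝒳.prop_of_iso ((HomologicalComplex.cyclesFunctor _ _ i).mapIso e) (h.2 i)⟩

lemma cProjectiveModules_prod {C M N : ModuleCat.{u} R} (hM : cProjectiveModules C M)
    (hN : cProjectiveModules C N) : cProjectiveModules C (ModuleCat.of R (M × N)) := by
  obtain ⟨P, hP, ⟨e⟩⟩ := hM
  obtain ⟨Q, hQ, ⟨f⟩⟩ := hN
  exact ⟨ModuleCat.of R (P × Q), (inferInstance : Module.Projective R (P × Q)),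
    ⟨(e.prodCongr f).trans (TensorProduct.prodRight R R C P Q).symm⟩⟩

lemma nonempty_disk_biprod_iso (M N : ℤ → ModuleCat.{u} R) :
    Nonempty (disk M ⊞ disk N ≅ disk (fun j => ModuleCat.of R (M j × N j))) := by
  let i₁ (j) : M j ⟶ ModuleCat.of R (M j × N j) := ModuleCat.ofHom (LinearMap.inl R _ _)
  let i₂ (j) : N j ⟶ ModuleCat.of R (M j × N j) := ModuleCat.ofHom (LinearMap.inr R _ _)
  let p₁ (j) : ModuleCat.of R (M j × N j) ⟶ M j := ModuleCat.ofHom (LinearMap.fst R _ _)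
  let p₂ (j) : ModuleCat.of R (M j × N j) ⟶ N j := ModuleCat.ofHom (LinearMap.snd R _ _)
  refine ⟨⟨biprod.desc (diskMap i₁) (diskMap i₂), biprod.lift (diskMap p₁) (diskMap p₂), ?_, ?_⟩⟩
  · refine biprod.hom_ext' _ _ (biprod.hom_ext _ _ ?_ ?_) (biprod.hom_ext _ _ ?_ ?_)
    · simp only [Category.assoc, biprod.inl_desc_assoc, biprod.lift_fst, diskMap_comp]
      rw [Category.id_comp, biprod.inl_fst]
      exact diskMap_id M
    · simp only [Category.assoc, biprod.inl_desc_assoc, biprod.lift_snd, diskMap_comp]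
      rw [Category.id_comp, biprod.inl_snd]
      exact diskMap_zero
    · simp only [Category.assoc, biprod.inr_desc_assoc, biprod.lift_fst, diskMap_comp]
      rw [Category.id_comp, biprod.inr_fst]
      exact diskMap_zero
    · simp only [Category.assoc, biprod.inr_desc_assoc, biprod.lift_snd, diskMap_comp]
      rw [Category.id_comp, biprod.inr_snd]
      exact diskMap_id N
  · rw [biprod.lift_desc, diskMap_comp, diskMap_comp]
    ext j x
    have h₁ := diskMap_f_apply (fun j => p₁ j ≫ i₁ j) j x
    have h₂ := diskMap_f_apply (fun j => p₂ j ≫ i₂ j) j x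
    refine (congrArg₂ (· + ·) h₁ h₂).trans (Prod.ext (Prod.ext ?_ ?_) (Prod.ext ?_ ?_))
    · exact add_zero _
    · exact zero_add _
    · exact add_zero _
    · exact zero_add _

lemma projectiveComplexes.nonempty_iso_disk {P : ChainComplex (ModuleCat.{u} R) ℤ}
    (hP : projectiveComplexes R P) :
    ∃ M : ℤ → ModuleCat.{u} R, (∀ j, Projective (M j)) ∧ Nonempty (P ≅ disk M) := by
  have h (j : ℤ) : Projective (P.opcycles j) :=
    (IsProjective.iff_projective (R := R) _).1 (prop_opcycles_of_tildeClass _ hP j)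
  exact ⟨fun j => P.opcycles j, h,
    (Splicing.ofAcyclic P hP.1).nonempty_iso_disk_of_extVanishes
      fun j => ExtVanishes.of_projective _ _⟩

lemma projectiveComplexes.projective {P : ChainComplex (ModuleCat.{u} R) ℤ}
    (hP : projectiveComplexes R P) : Projective P := by
  obtain ⟨M, hM, ⟨e⟩⟩ := hP.nonempty_iso_disk
  exact Projective.of_iso e.symm inferInstance

variable {C : ModuleCat.{u} R}

lemma cProjectiveComplexes.nonempty_iso_disk (hC : IsSemidualizing C)
    {Q : ChainComplex (ModuleCat.{u} R) ℤ} (hQ : cProjectiveComplexes C Q) :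
    ∃ M : ℤ → ModuleCat.{u} R, (∀ j, cProjectiveModules C (M j)) ∧ Nonempty (Q ≅ disk M) := by
  have h := prop_opcycles_of_tildeClass _ hQ
  exact ⟨fun j => Q.opcycles j, h,
    (Splicing.ofAcyclic Q hQ.1).nonempty_iso_disk_of_extVanishes
      fun j => hC.extVanishes (h j) (cProjectiveModules_le_cFlatModules C _ (h (j + 1)))⟩

/-- Self-orthogonality of `C`-projective modules makes both complexes sums of disks, and these add
degreewise. -/
lemma cProjectiveComplexes_biprod (hC : IsSemidualizing C)
    {Q Q' : ChainComplex (ModuleCat.{u} R) ℤ} (hQ : cProjectiveComplexes C Q)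
    (hQ' : cProjectiveComplexes C Q') : cProjectiveComplexes C (Q ⊞ Q') := by
  obtain ⟨M, hM, ⟨e⟩⟩ := hQ.nonempty_iso_disk hC
  obtain ⟨N, hN, ⟨f⟩⟩ := hQ'.nonempty_iso_disk hC
  obtain ⟨k⟩ := nonempty_disk_biprod_iso M N
  exact (tildeClass (cProjectiveModules C)).prop_of_iso ((biprod.mapIso e f).trans k).symm
    (tildeClass_disk _ _ fun j => cProjectiveModules_prod (hM j) (hN j))

/-- The complexes `X` with `Ext^n(X, H) = 0` for all `n ≥ 1` and all `C`-flat complexes `H`. -/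
def cFlatOrthogonal (C : ModuleCat.{u} R) : ObjectProperty (ChainComplex (ModuleCat.{u} R) ℤ) :=
  fun X => ∀ H, cFlatComplexes C H → ExtVanishes X H

/-- Each term of `H` is an extension of `C`-flat opcycles, so Ext into it vanishes even if the term
itself is not known to be `C`-flat. -/
lemma cFlatOrthogonal_disk {M : ℤ → ModuleCat.{u} R}
    (hM : ∀ j N, cFlatModules C N → ExtVanishes (M j) N) : cFlatOrthogonal C (disk M) := by
  intro H hH
  have h := prop_opcycles_of_tildeClass _ hH
  exact extVanishes_disk fun j => ExtVanishes.of_shortExact_right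
    ((Splicing.ofAcyclic H hH.1).shortExact j) (hM j _ (h _)) (hM j _ (h _))

lemma projectiveComplexes.cFlatOrthogonal {P : ChainComplex (ModuleCat.{u} R) ℤ}
    (hP : projectiveComplexes R P) : cFlatOrthogonal C P :=
  have := hP.projective
  fun _ _ => ExtVanishes.of_projective _ _

lemma cProjectiveComplexes.cFlatOrthogonal (hC : IsSemidualizing C)
    {Q : ChainComplex (ModuleCat.{u} R) ℤ} (hQ : cProjectiveComplexes C Q) :
    cFlatOrthogonal C Q := by
  obtain ⟨M, hM, ⟨e⟩⟩ := hQ.nonempty_iso_disk hC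
  exact fun H hH => (cFlatOrthogonal_disk (fun j N hN => hC.extVanishes (hM j) hN) H hH).of_iso_left
    e.symm

end Classes

/-! ### Coresolved complexes and `D_C`-projectivity. -/

section Coresolution

variable {R : Type u} [CommRing R] {C : ModuleCat.{u} R}

/-- The complexes `X` that are orthogonal to the `C`-flat complexes and embed into a
`C`-projective complex with cokernel in `𝒢`. -/
def coresolutionStep (C : ModuleCat.{u} R)
    (𝒢 : ObjectProperty (ChainComplex (ModuleCat.{u} R) ℤ)) :
    ObjectProperty (ChainComplex (ModuleCat.{u} R) ℤ) :=
  fun X => cFlatOrthogonal C X ∧ ∃ (Q Y : ChainComplex (ModuleCat.{u} R) ℤ) (f : X ⟶ Q)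
    (g : Q ⟶ Y) (w : f ≫ g = 0), (ShortComplex.mk f g w).ShortExact ∧
      cProjectiveComplexes C Q ∧ 𝒢 Y

/-- The largest class of complexes stable under `coresolutionStep`. -/
def coresolved (C : ModuleCat.{u} R) : ObjectProperty (ChainComplex (ModuleCat.{u} R) ℤ) :=
  fun X => ∃ 𝒢 : ObjectProperty (ChainComplex (ModuleCat.{u} R) ℤ),
    𝒢 ≤ coresolutionStep C 𝒢 ∧ 𝒢 X

lemma coresolutionStep_mono {𝒢 ℋ : ObjectProperty (ChainComplex (ModuleCat.{u} R) ℤ)}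
    (h : 𝒢 ≤ ℋ) : coresolutionStep C 𝒢 ≤ coresolutionStep C ℋ := by
  rintro X ⟨hX, Q, Y, f, g, w, hS, hQ, hY⟩
  exact ⟨hX, Q, Y, f, g, w, hS, hQ, h _ hY⟩

/-- The coinduction principle: one step that stays within a class replaces the construction of an
infinite coresolution. -/
lemma le_coresolved {𝒢 : ObjectProperty (ChainComplex (ModuleCat.{u} R) ℤ)}
    (h : 𝒢 ≤ coresolutionStep C 𝒢) : 𝒢 ≤ coresolved C :=
  fun _ hX => ⟨𝒢, h, hX⟩

lemma coresolved_le_step : coresolved C ≤ coresolutionStep C (coresolved C) := by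
  rintro X ⟨𝒢, h, hX⟩
  exact coresolutionStep_mono (le_coresolved h) _ (h _ hX)

lemma step_le_coresolved : coresolutionStep C (coresolved C) ≤ coresolved C :=
  le_coresolved (coresolutionStep_mono coresolved_le_step)

instance : (coresolved C).IsClosedUnderIsomorphisms where
  of_iso {X X'} e hX := by
    obtain ⟨hX, Q, Y, f, g, w, hS, hQ, hY⟩ := coresolved_le_step _ hX
    refine step_le_coresolved _ ⟨fun H hH => (hX H hH).of_iso_left e, Q, Y, e.inv ≫ f, g,
      by rw [Category.assoc, w, comp_zero], ?_, hQ, hY⟩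
    let k : ShortComplex.mk f g w ≅ ShortComplex.mk (e.inv ≫ f) g
        (by rw [Category.assoc, w, comp_zero]) :=
      ShortComplex.isoMk e (Iso.refl _) (Iso.refl _) (by simp) (by simp)
    exact ShortComplex.shortExact_of_iso k hS

/-- The class `coresolved C` is closed under extensions. -/
lemma coresolved_of_shortExact (hC : IsSemidualizing C)
    {S : ShortComplex (ChainComplex (ModuleCat.{u} R) ℤ)} (hS : S.ShortExact)
    (h₁ : coresolved C S.X₁) (h₃ : coresolved C S.X₃) : coresolved C S.X₂ := by
  refine le_coresolved (𝒢 := fun X => ∃ S : ShortComplex (ChainComplex (ModuleCat.{u} R) ℤ),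
    S.ShortExact ∧ coresolved C S.X₁ ∧ coresolved C S.X₃ ∧ X = S.X₂) ?_ _ ⟨S, hS, h₁, h₃, rfl⟩
  rintro _ ⟨S, hS, h₁, h₃, rfl⟩
  obtain ⟨hW₁, QA, A', a, π, wa, ha, hQA, hA'⟩ := coresolved_le_step _ h₁
  obtain ⟨hW₃, QD, D', d, ρ, wd, hd, hQD, hD'⟩ := coresolved_le_step _ h₃
  -- `QA` is also a `C`-flat complex, so `Ext^1(S.X₃, QA) = 0` and `a` extends to the middle term.
  obtain ⟨v, hv⟩ := (hW₃ QA (tildeClass_mono (cProjectiveModules_le_cFlatModules C) _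
    hQA)).exists_extension hS a
  obtain ⟨B', A'', D'', m, n, wm, x, y, wx, hmn, hxy, ⟨i⟩, ⟨j⟩⟩ :=
    exists_horseshoe hS ha hd v hv
  exact ⟨fun H hH => (hW₁ H hH).of_shortExact₂ hS (hW₃ H hH), _, B', m, n, wm, hmn,
    cProjectiveComplexes_biprod hC hQA hQD, ShortComplex.mk x y wx, hxy,
    (coresolved C).prop_of_iso i.symm hA', (coresolved C).prop_of_iso j.symm hD', rfl⟩

/-- Projective complexes are coresolved by `C`-projective complexes. -/
lemma projectiveComplexes_le_coresolved (hC : IsSemidualizing C) :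
    projectiveComplexes R ≤ coresolved C := by
  intro P hP
  obtain ⟨M, hM, ⟨e⟩⟩ := hP.nonempty_iso_disk
  choose T Q f g w e' hS hQ hT using fun j =>
    hC.exists_coresolution (M j) ((IsProjective.iff_projective _).2 (hM j))
  have h : coresolved C (disk (fun j => T j 0)) := by
    refine le_coresolved (𝒢 := fun X => ∃ m, X = disk (fun j => T j m)) ?_ _ ⟨0, rfl⟩
    rintro _ ⟨m, rfl⟩
    exact ⟨cFlatOrthogonal_disk fun j N hN => hT j m N hN, _, _, _, _, _,
      disk_shortExact _ _ _ (fun j => hS j m), tildeClass_disk _ _ (fun j => hQ j m),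
      m + 1, rfl⟩
  let k (j) : M j ≅ T j 0 := (e' j).some
  have hk : Nonempty (disk M ≅ disk (fun j => T j 0)) := by
    refine ⟨⟨diskMap fun j => (k j).hom, diskMap fun j => (k j).inv, ?_, ?_⟩⟩
    · rw [diskMap_comp]
      simp only [Iso.hom_inv_id]
      exact diskMap_id M
    · rw [diskMap_comp]
      simp only [Iso.inv_hom_id]
      exact diskMap_id _
  exact (coresolved C).prop_of_iso (e ≪≫ hk.some).symm h

/-- Kernels of epimorphisms from projective complexes onto coresolved complexes are coresolved. -/
lemma coresolved_of_shortExact_projective (hC : IsSemidualizing C)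
    {S : ShortComplex (ChainComplex (ModuleCat.{u} R) ℤ)} (hS : S.ShortExact)
    (h₂ : projectiveComplexes R S.X₂) (h₃ : coresolved C S.X₃) : coresolved C S.X₁ := by
  obtain ⟨hW, Q, Y, f, g, w, hQY, hQ, hY⟩ :=
    coresolved_le_step _ (projectiveComplexes_le_coresolved hC _ h₂)
  have : Mono f := hQY.mono_f
  have : Mono S.f := hS.mono_f
  -- Inside `Q`, the quotient by `S.X₁` is an extension of `Y` by `S.X₃`.
  obtain ⟨a, b, w', hab⟩ := exists_shortExact_cokernel_comp S.f f
  obtain ⟨i⟩ := nonempty_cokernel_iso hS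
  obtain ⟨j⟩ := nonempty_cokernel_iso hQY
  refine step_le_coresolved _ ⟨fun H hH => (hW H hH).of_shortExact₁ hS
    ((coresolved_le_step _ h₃).1 H hH), Q, _, S.f ≫ f, cokernel.π _, cokernel.condition _,
    { exact := ShortComplex.exact_of_g_is_cokernel _ (cokernelIsCokernel _)
      mono_f := mono_comp _ _ }, hQ, ?_⟩
  exact coresolved_of_shortExact hC hab ((coresolved C).prop_of_iso i.symm h₃)
    ((coresolved C).prop_of_iso j.symm hY)

lemma IsDCProjective.of_iso {X Y : ChainComplex (ModuleCat.{u} R) ℤ} (e : X ≅ Y)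
    (h : IsDCProjective C X) : IsDCProjective C Y := by
  obtain ⟨E, hE, ⟨f⟩⟩ := h
  exact ⟨E, hE, ⟨e.symm ≪≫ f⟩⟩

/-- A coresolved complex is `D_C`-projective. -/
lemma isDCProjective_of_coresolved {X : ChainComplex (ModuleCat.{u} R) ℤ}
    (hX : coresolved C X) : IsDCProjective C X := by
  choose K P a b wab hab hP hPp using exists_shortExact_projectiveComplexes (R := R)
  choose Q N f g wfg hfg hQ hN using fun Y : { Y // coresolved C Y } =>
    (coresolved_le_step _ Y.2).2
  let l : ℕ → ChainComplex (ModuleCat.{u} R) ℤ := fun n => K^[n] X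
  have hl (n : ℕ) : l (n + 1) = K (l n) := Function.iterate_succ_apply' K n X
  let r : ℕ → { Y // coresolved C Y } := fun n => (fun Y => ⟨N Y, hN Y⟩)^[n] ⟨X, hX⟩
  have hr (n : ℕ) : (r (n + 1)).1 = N (r n) :=
    congrArg Subtype.val (Function.iterate_succ_apply' _ n _)
  have hlW (n : ℕ) : cFlatOrthogonal C (l n) := by
    induction n with
    | zero => exact (coresolved_le_step _ hX).1
    | succ n ih =>
      rw [hl]
      have := hPp (l n)
      exact fun H hH => ExtVanishes.of_shortExact₁ (hab (l n))
        (ExtVanishes.of_projective (P (l n)) H) (ih H hH)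
  -- Syzygies of `X` sit in nonnegative degrees and cosyzygies in negative ones. Both iterations
  -- start at `X`, which appears once, as `Z 0`.
  let Z : ℤ → ChainComplex (ModuleCat.{u} R) ℤ
    | .ofNat n => l n
    | .negSucc n => (r (n + 1)).1
  have hZW (j : ℤ) : cFlatOrthogonal C (Z j) := match j with
    | .ofNat n => hlW n
    | .negSucc n => (coresolved_le_step _ (r (n + 1)).2).1
  have hZ (j : ℤ) : ∃ (E : ChainComplex (ModuleCat.{u} R) ℤ) (i : Z (j + 1) ⟶ E) (p : E ⟶ Z j)
      (w : i ≫ p = 0), (ShortComplex.mk i p w).ShortExact ∧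
        (0 ≤ j → projectiveComplexes R E) ∧ (j < 0 → cProjectiveComplexes C E) := by
    have hleft {A B : ChainComplex (ModuleCat.{u} R) ℤ} (h : A = K B) (hj : 0 ≤ j) :
        ∃ (E : ChainComplex (ModuleCat.{u} R) ℤ) (i : A ⟶ E) (p : E ⟶ B)
          (w : i ≫ p = 0), (ShortComplex.mk i p w).ShortExact ∧
          (0 ≤ j → projectiveComplexes R E) ∧ (j < 0 → cProjectiveComplexes C E) := by
      subst h
      exact ⟨_, _, _, _, hab B, fun _ => hP _, fun h => absurd h hj.not_gt⟩
    have hright {B : ChainComplex (ModuleCat.{u} R) ℤ} (A : { Y // coresolved C Y })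
        (h : B = N A) (hj : j < 0) :
        ∃ (E : ChainComplex (ModuleCat.{u} R) ℤ) (i : A.1 ⟶ E) (p : E ⟶ B)
          (w : i ≫ p = 0), (ShortComplex.mk i p w).ShortExact ∧
          (0 ≤ j → projectiveComplexes R E) ∧ (j < 0 → cProjectiveComplexes C E) := by
      subst h
      exact ⟨_, _, _, _, hfg A, fun h => absurd h hj.not_ge, fun _ => hQ _⟩
    match j with
    | .ofNat n => exact hleft (hl n) (Int.natCast_nonneg n)
    -- The junction: `Z 0` is written `l 0` but must be read as `r 0`, both being `X`.
    | .negSucc 0 => exact hright (r 0) (hr 0) (Int.negSucc_lt_zero 0)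
    | .negSucc (n + 1) => exact hright (r (n + 1)) (hr (n + 1)) (Int.negSucc_lt_zero _)
  choose E i p w hS hEP hEQ using hZ
  let s := spliceSplicing i p w hS
  refine ⟨splice i p w,
    { exact := s.acyclic
      homExact := (s.isHomExact_iff_exists_extension _).2 fun B hB j a =>
        (hZW j B hB).exists_extension (hS j) a
      projective := hEP
      cProjective := hEQ }, ?_⟩
  obtain ⟨e⟩ := s.nonempty_imageIso 0 (-1) rfl
  exact ⟨e.symm⟩

variable {E : ChainComplex (ChainComplex (ModuleCat.{u} R) ℤ) ℤ}

/-- Dimension shifting along `E`: all terms are orthogonal, and Hom-exactness is the extension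
property needed in degree one. -/
lemma IsPQSequence.cFlatOrthogonal_opcycles (hC : IsSemidualizing C) (hE : IsPQSequence C E)
    (j : ℤ) : cFlatOrthogonal C (E.opcycles j) := by
  let s := Splicing.ofAcyclic E hE.exact
  have hW (j : ℤ) : cFlatOrthogonal C (E.X j) := by
    rcases le_or_gt 0 j with hj | hj
    · exact (hE.projective j hj).cFlatOrthogonal
    · exact (hE.cProjective j hj).cFlatOrthogonal hC
  intro H hH
  refine ExtVanishes.of_forall_exists_shortExact (fun X => ∃ j, X = E.opcycles j) H ?_ ⟨j, rfl⟩
  rintro _ ⟨j, rfl⟩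
  exact ⟨_, _, _, _, _, s.shortExact j, ⟨j + 1, rfl⟩, hW j H hH,
    (s.isHomExact_iff_exists_extension _).1 hE.homExact H hH j⟩

lemma IsPQSequence.coresolved_opcycles (hC : IsSemidualizing C) (hE : IsPQSequence C E)
    (j : ℤ) : coresolved C (E.opcycles j) := by
  let s := Splicing.ofAcyclic E hE.exact
  have hneg {j : ℤ} (hj : j ≤ 0) : coresolved C (E.opcycles j) := by
    -- For `j ≤ 0` the object embeds in the term of index `j - 1`, which is negative and so
    -- `C`-projective, with the next opcycles as cokernel.
    refine le_coresolved (𝒢 := fun X => ∃ j ≤ 0, X = E.opcycles j) ?_ _ ⟨j, hj, rfl⟩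
    rintro _ ⟨j, hj, rfl⟩
    obtain ⟨k, rfl⟩ : ∃ k, k + 1 = j := ⟨j - 1, by ring⟩
    exact ⟨hE.cFlatOrthogonal_opcycles hC _, _, _, _, _, _, s.shortExact k,
      hE.cProjective k (by omega), k, by omega, rfl⟩
  rcases le_total j 0 with hj | hj
  · exact hneg hj
  · induction j, hj using Int.leInduction with
    | base => exact hneg le_rfl
    | succ j hj ih =>
      -- The opcycles at `j + 1` are the kernel of the map from the projective complex `E.X j` onto
      -- those at `j`.
      exact coresolved_of_shortExact_projective hC (s.shortExact j) (hE.projective j hj) ih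

end Coresolution

end DingC

theorem corollary2p13 {R : Type u} [CommRing R] (C : ModuleCat.{u} R)
    (hC : DingC.IsSemidualizing C)
    (E : ChainComplex (ChainComplex (ModuleCat.{u} R) ℤ) ℤ)
    (hExact : E.Acyclic)
    (hHom : DingC.IsHomExact (DingC.cFlatComplexes C) E)
    (hP : ∀ i : ℤ, 0 ≤ i → DingC.projectiveComplexes R (E.X i))
    (hQ : ∀ i : ℤ, i < 0 → DingC.cProjectiveComplexes C (E.X i)) :
    ∀ i : ℤ, DingC.IsDCProjective C (cokernel (E.d i (i - 1))) := by
  intro i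
  have hE : DingC.IsPQSequence C E := ⟨hExact, hHom, hP, hQ⟩
  obtain ⟨e⟩ := (DingC.Splicing.ofAcyclic E hExact).nonempty_cokernelIso i (i - 1) (by ring)
  exact (DingC.isDCProjective_of_coresolved (hE.coresolved_opcycles hC (i - 1))).of_iso e.symm
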